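/- Let $r\ge 2$. An $r$-graphon is a symmetric measurable function $W:[0,1]^r\to[0,1]$; a graphon is a symmetric measurable function $[0,1]^2\to[0,1]$. For $r$-graphons $U,W$ put $$\delta_{\square,1}(U,W)=\inf_{\varphi}\ \sup_{f_1,\dots,f_r}\Big|\int_{[0,1]^r}\big(U(x_1,\dots,x_r)-W(\varphi(x_1),\dots,\varphi(x_r))\big)f_1(x_1)\cdots f_r(x_r)\,dx_1\cdots dx_r\Big|,$$ and for graphons $U,W$ put $$\delta_{\square}(U,W)=\inf_{\varphi}\ \sup_{f,g}\Big|\int_{[0,1]^2}\big(U(x,y)-W(\varphi(x),\varphi(y))\big)f(x)g(y)\,dx\,dy\Big|,$$ where the infima are over measure preserving maps $\varphi:[0,1]\to[0,1]$ and the suprema over measurable functions $[0,1]\to[0,1]$. The codegree-section of an $r$-graphon $W$ is the graphon $$G[W](x,y)=\frac1{(r-2)!}\int_{[0,1]^{r-2}}W(x,x_2,\dots,x_{r-1},y)\,dx_2\cdots dx_{r-1}.$$ For a square-integrable $K:[0,1]^2\to\mathbb R$ let $\mathcal A_K$ be the operator $(\mathcal A_Kf)(x)=\int_0^1K(x,y)f(y)\,dy$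 on the real space $L^2([0,1])$. For a graphon $V$ let $d_V(x)=\int_0^1V(x,y)\,dy$, let $K_V(x,y)=V(x,y)/d_V(x)$ if $d_V(x)>0$ and $K_V(x,y)=0$ otherwise, and, if $K_V$ is square-integrable, let $\mathcal L_V=\mathrm{Id}-\mathcal A_{K_V}$ be the random walk Laplacian. Pointwise convergence of spectra of operators $T_n$ to that of $T$, relative to a point $c$ ($c=0$ for the kernel operators $\mathcal A_V$, $c=1$ for the Laplacians $\mathcal L_V$), means: for each of these operators, every point $\mu\ne c$ of the (real) spectrum is an eigenvalue, with finite-dimensional eigenspace; the eigenvalues above $c$, counted with multiplicity, can be listed in decreasing order and those below $c$ in increasing order, each list either converging to $c$ or being finite and then continued by the constant $c$; and for every $i$, the $i$-th entries of the two lists of $T_n$ converge, as $n\to\infty$, to the $i$-th entries of the corresponding lists of $T$. Let $(W_n)_n$ be a sequence of $r$-graphons and $W$ an $r$-graphon with $\delta_{\square,1}(W_n,W)\to0$. Then: 1. $\delta_\square(G[W_n],G[W])\to0$. 2. The spectra of the kernel operators $\mathcal A_{G[W_n]}$ converge pointwise to the spectrum of $\mathcal A_{G[W]}$. 3. If in addition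 there is an $\varepsilon>0$ such that, for every $n$, $d_{G[W_n]}>\varepsilon$ almost everywhere, then the random walk kernels of all $G[W_n]$ and of $G[W]$ are square-integrable, and the spectra of the random walk Laplacians $\mathcal L_{G[W_n]}$ converge pointwise to the spectrum of $\mathcal L_{G[W]}$. -/

import Mathlib

open MeasureTheory Filter Topology
open scoped unitInterval

namespace HypergraphLimit

noncomputable section

/-! Throughout, `I = [0,1]` carries the Lebesgue (probability) measure `volume`, and finite
powers of `I` carry the product measure. -/

/-! ### Graphons and the cut metric -/

/-- A graphon: a symmetric measurable function `[0,1]² → [0,1]`. -/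
structure Graphon where
  toFun : I → I → ℝ
  measurable' : Measurable (Function.uncurry toFun)
  symm' : ∀ x y, toFun x y = toFun y x
  mem_Icc' : ∀ x y, toFun x y ∈ Set.Icc (0 : ℝ) 1

instance : CoeFun Graphon (fun _ => I → I → ℝ) := ⟨Graphon.toFun⟩

/-- The measurable functions `[0,1] → [0,1]`, over which the suprema in the cut norms range. -/
abbrev TestFun : Type := {f : I → I // Measurable f}

/-- The measure preserving maps `[0,1] → [0,1]` (not necessarily invertible). -/
abbrev MPMap : Type := {φ : I → I // MeasurePreserving φ volume volume}

/-- The cut norm `sup_{f,g} |∫ U(x,y) f(x) g(y) dx dy|` of a bounded measurable function `U`. -/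
def cutNorm (U : I → I → ℝ) : ℝ :=
  ⨆ fg : TestFun × TestFun,
    |∫ p : I × I, U p.1 p.2 * (fg.1.1 p.1 : ℝ) * (fg.2.1 p.2 : ℝ)|

/-- The cut metric `inf_φ ‖U - W^φ‖`, where `W^φ(x,y) = W(φ x, φ y)`. -/
def cutDist (U W : Graphon) : ℝ :=
  ⨅ φ : MPMap, cutNorm (fun x y => U x y - W (φ.1 x) (φ.1 y))

/-! ### `r`-graphons and the 1-cut metric -/

/-- An `r`-graphon: a symmetric measurable function `[0,1]^r → [0,1]`. -/
structure RGraphon (r : ℕ) where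
  toFun : (Fin r → I) → ℝ
  measurable' : Measurable toFun
  symm' : ∀ (τ : Equiv.Perm (Fin r)) (x : Fin r → I), toFun (x ∘ τ) = toFun x
  mem_Icc' : ∀ x, toFun x ∈ Set.Icc (0 : ℝ) 1

instance (r : ℕ) : CoeFun (RGraphon r) (fun _ => (Fin r → I) → ℝ) := ⟨RGraphon.toFun⟩

/-- The 1-cut norm `sup_{f₁,…,f_r} |∫ U(x₁,…,x_r) f₁(x₁)⋯f_r(x_r) dx|` of a bounded measurable
function `U` on `[0,1]^r`. -/
def oneCutNorm {r : ℕ} (U : (Fin r → I) → ℝ) : ℝ :=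
  ⨆ f : Fin r → TestFun, |∫ x : Fin r → I, U x * ∏ i, ((f i).1 (x i) : ℝ)|

/-- The 1-cut metric `inf_φ ‖U - W^φ‖`, where `W^φ(x₁,…,x_r) = W(φ x₁,…,φ x_r)`. -/
def oneCutDist {r : ℕ} (U W : RGraphon r) : ℝ :=
  ⨅ φ : MPMap, oneCutNorm (fun x => U x - W (fun i => φ.1 (x i)))

/-! ### The codegree-section -/

/-- The point `(x, z₁, …, z_k, y)` of `[0,1]^(k+2)`. -/
def endpoints {k : ℕ} (x y : I) (z : Fin k → I) : Fin (k + 2) → I :=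
  Fin.cons x (Fin.snoc z y)

lemma measurable_endpoints {k : ℕ} :
    Measurable (fun q : (I × I) × (Fin k → I) => endpoints q.1.1 q.1.2 q.2) := by
  refine measurable_pi_lambda _ fun i => ?_
  refine Fin.cases ?_ (fun j => ?_) i
  · simp only [endpoints, Fin.cons_zero]
    fun_prop
  · refine Fin.lastCases ?_ (fun l => ?_) j
    · simp only [endpoints, Fin.cons_succ, Fin.snoc_last]
      fun_prop
    · simp only [endpoints, Fin.cons_succ, Fin.snoc_castSucc]
      fun_prop

lemma endpoints_swap {k : ℕ} (x y : I) (z : Fin k → I) :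
    endpoints y x z =
      endpoints x y z ∘ (Equiv.swap (0 : Fin (k + 2)) (Fin.last (k + 1))) := by
  have h0 : (0 : Fin (k + 2)) ≠ Fin.last (k + 1) := by simp [Fin.ext_iff]
  funext i
  refine Fin.cases ?_ (fun j => ?_) i
  · simp [endpoints, ← Fin.succ_last]
  · refine Fin.lastCases ?_ (fun l => ?_) j
    · rw [Function.comp_apply, Fin.succ_last, Equiv.swap_apply_right, ← Fin.succ_last]
      simp [endpoints]
    · rw [Function.comp_apply, Equiv.swap_apply_of_ne_of_ne]
      · simp [endpoints]
      · exact Fin.succ_ne_zero _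
      · rw [← Fin.succ_last]
        exact fun h => (Fin.castSucc_lt_last l).ne (Fin.succ_injective _ h)

/-- The codegree-section of an `r`-graphon, `r = k + 2`: the graphon
`G[W](x,y) = 1/(r-2)! ∫ W(x, x₂, …, x_{r-1}, y) dx₂ ⋯ dx_{r-1}`. -/
def codegreeSection {k : ℕ} (W : RGraphon (k + 2)) : Graphon where
  toFun x y := (1 / (k.factorial : ℝ)) * ∫ z : Fin k → I, W (endpoints x y z)
  measurable' := by
    have h : StronglyMeasurable
        (fun q : (I × I) × (Fin k → I) => W (endpoints q.1.1 q.1.2 q.2)) :=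
      (W.measurable'.comp measurable_endpoints).stronglyMeasurable
    exact (h.integral_prod_right'.measurable).const_mul _
  symm' x y := by
    congr 1
    refine integral_congr_ae (Eventually.of_forall fun z => ?_)
    simp only [endpoints_swap x y z]
    exact (W.symm' _ _).symm
  mem_Icc' x y := by
    have h0 : 0 ≤ ∫ z : Fin k → I, W (endpoints x y z) :=
      integral_nonneg fun z => (W.mem_Icc' _).1
    have h1 : ∫ z : Fin k → I, W (endpoints x y z) ≤ 1 := by
      have := integral_mono_of_nonneg (μ := (volume : Measure (Fin k → I)))
        (Eventually.of_forall fun z => (W.mem_Icc' (endpoints x y z)).1)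
        (integrable_const (1 : ℝ))
        (Eventually.of_forall fun z => (W.mem_Icc' (endpoints x y z)).2)
      simpa using this
    have hk : (1 / (k.factorial : ℝ)) ≤ 1 := by
      rw [div_le_one (by positivity)]
      exact_mod_cast Nat.one_le_iff_ne_zero.mpr k.factorial_ne_zero
    exact ⟨by positivity, mul_le_one₀ hk h0 h1⟩

/-! ### Kernel operators and the random walk Laplacian on `L²([0,1])` -/

/-- The real Hilbert space `L²([0,1])`. -/
abbrev L2 : Type := Lp ℝ 2 (volume : Measure I)

/-- Square-integrability of a function `K` on `[0,1]²`. -/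
abbrev SquareIntegrable (K : I → I → ℝ) : Prop :=
  MemLp (Function.uncurry K) 2 (volume : Measure (I × I))

lemma SquareIntegrable.ae_memLp {K : I → I → ℝ} (hK : SquareIntegrable K) :
    ∀ᵐ x : I, MemLp (K x) 2 (volume : Measure I) := by
  have hi : Integrable (fun p : I × I => Function.uncurry K p ^ 2) (volume.prod volume) :=
    hK.integrable_sq
  filter_upwards [hK.aestronglyMeasurable.prodMk_left, hi.prod_right_ae] with x h1 h2
  exact (memLp_two_iff_integrable_sq h1).2 h2

lemma SquareIntegrable.ae_integrable_mul {K : I → I → ℝ} (hK : SquareIntegrable K) (f : L2) :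
    ∀ᵐ x : I, Integrable (fun y => K x y * f y) := by
  filter_upwards [hK.ae_memLp] with x hx
  exact hx.integrable_mul (Lp.memLp f)

lemma SquareIntegrable.eLpNorm_integral_le {K : I → I → ℝ} (hK : SquareIntegrable K) (f : L2) :
    eLpNorm (fun x => ∫ y, K x y * f y) 2 (volume : Measure I) ≤
      eLpNorm (Function.uncurry K) 2 volume * eLpNorm f 2 volume := by
  have hsq : ∀ {α : Type} [MeasurableSpace α] (μ : Measure α) (g : α → ℝ),
      eLpNorm g 2 μ ^ (2 : ℝ) = ∫⁻ a, ‖g a‖ₑ ^ (2 : ℝ) ∂μ := by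
    intro α _ μ g
    rw [eLpNorm_eq_lintegral_rpow_enorm_toReal (by norm_num) (by norm_num), ← ENNReal.rpow_mul]
    simp
  have hpt : ∀ᵐ x : I, ‖∫ y, K x y * f y‖ₑ ^ (2 : ℝ) ≤
      (∫⁻ y, ‖K x y‖ₑ ^ (2 : ℝ)) * eLpNorm f 2 volume ^ (2 : ℝ) := by
    filter_upwards [hK.ae_memLp] with x hx
    rw [← hsq volume (K x), ← ENNReal.mul_rpow_of_nonneg _ _ (by norm_num)]
    refine ENNReal.rpow_le_rpow ?_ (by norm_num)
    refine (enorm_integral_le_lintegral_enorm _).trans ?_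
    have hH := ENNReal.lintegral_mul_le_Lp_mul_Lq (volume : Measure I)
      Real.HolderConjugate.two_two hx.aestronglyMeasurable.enorm
      (Lp.aestronglyMeasurable f).enorm
    rw [eLpNorm_eq_lintegral_rpow_enorm_toReal (by norm_num) (by norm_num),
      eLpNorm_eq_lintegral_rpow_enorm_toReal (by norm_num) (by norm_num)]
    simpa [enorm_mul] using hH
  rw [← ENNReal.rpow_le_rpow_iff (z := (2 : ℝ)) (by norm_num),
    ENNReal.mul_rpow_of_nonneg _ _ (by norm_num), hsq volume (fun x => ∫ y, K x y * f y),
    hsq volume (Function.uncurry K)]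
  refine (lintegral_mono_ae hpt).trans ?_
  rw [lintegral_mul_const' _ _
    (ENNReal.rpow_ne_top_of_nonneg (by norm_num) (Lp.eLpNorm_ne_top f))]
  refine mul_le_mul_left ?_ _
  have hm : AEMeasurable (fun p : I × I => ‖Function.uncurry K p‖ₑ ^ (2 : ℝ))
      (volume.prod volume) := (hK.aestronglyMeasurable.enorm).pow_const _
  exact (lintegral_prod _ hm).symm.le

lemma SquareIntegrable.memLp_integral {K : I → I → ℝ} (hK : SquareIntegrable K) (f : L2) :
    MemLp (fun x => ∫ y, K x y * f y) 2 (volume : Measure I) := by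
  refine ⟨?_, (hK.eLpNorm_integral_le f).trans_lt
    (ENNReal.mul_lt_top hK.eLpNorm_lt_top (Lp.eLpNorm_lt_top f))⟩
  have hm : AEStronglyMeasurable (fun p : I × I => K p.1 p.2 * f p.2) (volume.prod volume) :=
    AEStronglyMeasurable.mul hK.aestronglyMeasurable (Lp.aestronglyMeasurable f).comp_snd
  exact hm.integral_prod_right'

/-- The kernel operator `(A_K f)(x) = ∫ K(x,y) f(y) dy` on `L²([0,1])` induced by a
square-integrable `K`. -/
def kernelOp (K : I → I → ℝ) (hK : SquareIntegrable K) : L2 →L[ℝ] L2 :=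
  LinearMap.mkContinuous
    { toFun := fun f => (hK.memLp_integral f).toLp (fun x => ∫ y, K x y * f y)
      map_add' := fun f g => by
        rw [← MemLp.toLp_add]
        refine MemLp.toLp_congr _ _ ?_
        filter_upwards [hK.ae_integrable_mul f, hK.ae_integrable_mul g] with x hf hg
        rw [Pi.add_apply, ← integral_add hf hg]
        refine integral_congr_ae ?_
        filter_upwards [Lp.coeFn_add f g] with y hy
        rw [hy, Pi.add_apply, mul_add]
      map_smul' := fun c f => by
        rw [RingHom.id_apply, ← MemLp.toLp_const_smul]
        refine MemLp.toLp_congr _ _ (Eventually.of_forall fun x => ?_)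
        simp only [Pi.smul_apply, smul_eq_mul]
        rw [← integral_const_mul]
        refine integral_congr_ae ?_
        filter_upwards [Lp.coeFn_smul c f] with y hy
        rw [hy, Pi.smul_apply, smul_eq_mul]
        ring }
    (eLpNorm (Function.uncurry K) 2 volume).toReal
    (fun f => by
      rw [LinearMap.coe_mk, AddHom.coe_mk, Lp.norm_toLp, Lp.norm_def, ← ENNReal.toReal_mul]
      exact ENNReal.toReal_mono
        (ENNReal.mul_ne_top hK.eLpNorm_ne_top (Lp.eLpNorm_ne_top f))
        (hK.eLpNorm_integral_le f))

lemma kernelOp_ae_eq (K : I → I → ℝ) (hK : SquareIntegrable K) (f : L2) :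
    kernelOp K hK f =ᵐ[volume] fun x => ∫ y, K x y * f y :=
  (hK.memLp_integral f).coeFn_toLp

lemma Graphon.squareIntegrable (W : Graphon) : SquareIntegrable W.toFun :=
  MemLp.of_bound W.measurable'.aestronglyMeasurable 1 (Eventually.of_forall fun p => by
    have h := W.mem_Icc' p.1 p.2
    simpa [Function.uncurry, abs_of_nonneg h.1] using h.2)

/-- The kernel operator `A_W` of a graphon. -/
def Graphon.op (W : Graphon) : L2 →L[ℝ] L2 := kernelOp W W.squareIntegrable

/-- The degree function `d_W(x) = ∫ W(x,y) dy`. -/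
def Graphon.degree (W : Graphon) (x : I) : ℝ := ∫ y, W x y

/-- The random walk kernel `K_W(x,y) = W(x,y) / d_W(x)` if `d_W(x) > 0`, and `0` otherwise. -/
def Graphon.rwKernel (W : Graphon) (x y : I) : ℝ :=
  open Classical in if 0 < W.degree x then W x y / W.degree x else 0

/-- The random walk Laplacian `L_W f = f - A_{K_W} f` of a graphon whose random walk kernel is
square-integrable. -/
def Graphon.laplacian (W : Graphon) (hW : SquareIntegrable W.rwKernel) : L2 →L[ℝ] L2 :=
  ContinuousLinearMap.id ℝ L2 - kernelOp W.rwKernel hW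

/-! ### Pointwise convergence of spectra -/

/-- The spectrum of `T` is real and discrete away from the point `c`, and it is enumerated, with
multiplicities, by `a` and `b`: `a` lists the spectral values above `c` in decreasing order, `b`
lists those below `c` in increasing order, and a list that is finite is continued by the constant
`c`. (For a compact operator `c = 0`; for the identity minus a compact operator `c = 1`.) -/
structure IsSpectralEnumeration (T : L2 →L[ℝ] L2) (c : ℝ) (a b : ℕ → ℝ) : Prop where
  hasEigenvalue : ∀ μ ∈ spectrum ℝ T, μ ≠ c →
    Module.End.HasEigenvalue (T : Module.End ℝ L2) μ
  finiteDimensional : ∀ μ : ℝ, μ ≠ c →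
    FiniteDimensional ℝ (Module.End.eigenspace (T : Module.End ℝ L2) μ)
  antitone : Antitone a
  tendsto_above : Tendsto a atTop (𝓝 c)
  monotone : Monotone b
  tendsto_below : Tendsto b atTop (𝓝 c)
  card_above : ∀ μ : ℝ, c < μ → {i : ℕ | a i = μ}.ncard =
    Module.finrank ℝ (Module.End.eigenspace (T : Module.End ℝ L2) μ)
  card_below : ∀ μ : ℝ, μ < c → {i : ℕ | b i = μ}.ncard =
    Module.finrank ℝ (Module.End.eigenspace (T : Module.End ℝ L2) μ)

/-- Pointwise convergence of the spectra of `T n` to the spectrum of `S`, for operators whose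
spectra are discrete away from `c`: for every `i`, the `i`-th largest spectral value above `c` and
the `i`-th smallest spectral value below `c` converge. -/
def SpectraConverge (T : ℕ → (L2 →L[ℝ] L2)) (S : L2 →L[ℝ] L2) (c : ℝ) : Prop :=
  ∃ (a b : ℕ → ℕ → ℝ) (a' b' : ℕ → ℝ),
    (∀ n, IsSpectralEnumeration (T n) c (a n) (b n)) ∧
    IsSpectralEnumeration S c a' b' ∧
    (∀ i, Tendsto (fun n => a n i) atTop (𝓝 (a' i))) ∧
    (∀ i, Tendsto (fun n => b n i) atTop (𝓝 (b' i)))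

end

end HypergraphLimit

/-! Everything reduces to graphons. Take the middle test functions equal to `1` in the 1-cut norm:
by Fubini this bounds the cut norm of the difference of codegree-sections, since `1/k! ≤ 1`. As `φ`
acts coordinatewise, taking sections commutes with pulling back along `φ`, so `cutDist` of sections
is at most `oneCutDist`. This is claim 1, and claims 2 and 3 use only cut convergence `U n → V` of
graphons.

For claim 2, choose `φ n` such that `U n - V^(φ n)` tends to `0` in cut norm. Truncating unit
vectors of `L²` at a level `M` shows that, for uniformly bounded kernels, smallness of the bilinear
form on bounded functions forces smallness of the operator norm. Eigenvalues are described by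
max-min of the quadratic form (`upperEigenvalue`), which makes them 1-Lipschitz in the operator
norm. The maps `φ n` need not be invertible, but the operator of `V^φ` is `C A_V C*` with `C` the
isometry `f ↦ f ∘ φ`, and this has the same max-min values as `A_V`. Compactness of Hilbert–Schmidt
operators and the spectral theorem identify these values with the enumeration of the spectrum
(`lt_upperEigenvalue_iff_lt_finrank`, `ncard_upperEigenvalue_eq`).

For claim 3, the kernel `V(x,y)/d(x)` is similar to the symmetric kernel `d(x)^(-1/2) V(x,y)
d(y)^(-1/2)` through multiplication by `d^(-1/2)`, which is invertible when `d ≥ ε`. Cut closeness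
makes the degrees `L¹`-close, so the lower bound passes to the limit and the symmetrized kernels are
close as forms on bounded functions. The argument of claim 2 applies to them, and the Laplacian
reflects the spectrum by `μ ↦ 1 - μ`. -/

namespace HypergraphLimit

/-! ### Variational description of the eigenvalues of compact symmetric operators -/

section Spectral

open Module.End

variable {H : Type*} [NormedAddCommGroup H] [InnerProductSpace ℝ H]

/-- The span of the eigenspaces of `T` for the eigenvalues in `s`. -/
def eigenspan (T : H →L[ℝ] H) (s : Set ℝ) : Submodule ℝ H :=
  ⨆ μ : s, eigenspace (T : Module.End ℝ H) μ

lemma eigenspace_le_eigenspan (T : H →L[ℝ] H) {s : Set ℝ} {μ : ℝ} (hμ : μ ∈ s) :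
    eigenspace (T : Module.End ℝ H) μ ≤ eigenspan T s :=
  le_iSup (fun μ : s => eigenspace (T : Module.End ℝ H) μ) ⟨μ, hμ⟩

lemma eigenspan_le_iff {T : H →L[ℝ] H} {s : Set ℝ} {F : Submodule ℝ H} :
    eigenspan T s ≤ F ↔ ∀ μ ∈ s, eigenspace (T : Module.End ℝ H) μ ≤ F := by
  simp [eigenspan, iSup_le_iff]

lemma eigenspan_mono_of_ne_bot {T : H →L[ℝ] H} {s t : Set ℝ}
    (h : ∀ μ ∈ s, eigenspace (T : Module.End ℝ H) μ ≠ ⊥ → μ ∈ t) :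
    eigenspan T s ≤ eigenspan T t := by
  rw [eigenspan_le_iff]
  intro μ hμ
  by_cases hb : eigenspace (T : Module.End ℝ H) μ = ⊥
  · simp [hb]
  · exact eigenspace_le_eigenspan T (h μ hμ hb)

/-- Eigenspaces of a symmetric operator are mutually orthogonal, so on a finite sum of eigenvectors
both the norm and the quadratic form are diagonal. -/
lemma exists_sum_of_mem_eigenspan {T : H →L[ℝ] H} (hT : (T : H →ₗ[ℝ] H).IsSymmetric) {s : Set ℝ}
    {x : H} (hx : x ∈ eigenspan T s) :
    ∃ (F : Finset s) (f : s → H), ‖x‖ ^ 2 = ∑ μ ∈ F, ‖f μ‖ ^ 2 ∧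
      inner ℝ (T x) x = ∑ μ ∈ F, (μ : ℝ) * ‖f μ‖ ^ 2 := by
  obtain ⟨f, hf, rfl⟩ := (Submodule.mem_iSup_iff_exists_finsupp _ _).1 hx
  have hV := hT.orthogonalFamily_eigenspaces.comp (Subtype.val_injective (p := (· ∈ s)))
  let l : ∀ μ : s, eigenspace (T : Module.End ℝ H) μ := fun μ => ⟨f μ, hf μ⟩
  have h1 := hV.inner_sum l l f.support
  have h2 := hV.inner_sum (fun μ => (μ : ℝ) • l μ) l f.support
  have hTf : T (f.sum fun _ y => y) = ∑ μ ∈ f.support, (μ : ℝ) • f μ := by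
    rw [Finsupp.sum, map_sum]
    refine Finset.sum_congr rfl fun μ _ => ?_
    exact mem_eigenspace_iff.1 (hf μ)
  refine ⟨f.support, f, ?_, ?_⟩
  · rw [← real_inner_self_eq_norm_sq]
    simpa [l, Finsupp.sum] using h1
  · rw [hTf]
    simpa [l, Finsupp.sum, inner_smul_left, mul_comm] using h2

lemma le_inner_of_mem_eigenspan {T : H →L[ℝ] H} (hT : (T : H →ₗ[ℝ] H).IsSymmetric) {s : Set ℝ}
    {c : ℝ} (hs : ∀ μ ∈ s, c ≤ μ) {x : H} (hx : x ∈ eigenspan T s) :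
    c * ‖x‖ ^ 2 ≤ inner ℝ (T x) x := by
  obtain ⟨F, f, h1, h2⟩ := exists_sum_of_mem_eigenspan hT hx
  rw [h1, h2, Finset.mul_sum]
  exact Finset.sum_le_sum fun μ _ => mul_le_mul_of_nonneg_right (hs μ μ.2) (by positivity)

lemma inner_le_of_mem_eigenspan {T : H →L[ℝ] H} (hT : (T : H →ₗ[ℝ] H).IsSymmetric) {s : Set ℝ}
    {c : ℝ} (hs : ∀ μ ∈ s, μ ≤ c) {x : H} (hx : x ∈ eigenspan T s) :
    inner ℝ (T x) x ≤ c * ‖x‖ ^ 2 := by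
  obtain ⟨F, f, h1, h2⟩ := exists_sum_of_mem_eigenspan hT hx
  rw [h1, h2, Finset.mul_sum]
  exact Finset.sum_le_sum fun μ _ => mul_le_mul_of_nonneg_right (hs μ μ.2) (by positivity)

lemma eigenspan_isOrtho {T : H →L[ℝ] H} (hT : (T : H →ₗ[ℝ] H).IsSymmetric) {s t : Set ℝ}
    (hst : Disjoint s t) : eigenspan T s ⟂ eigenspan T t := by
  rw [eigenspan, eigenspan, Submodule.isOrtho_iSup_left]
  intro μ
  rw [Submodule.isOrtho_iSup_right]
  intro ν
  rw [Submodule.isOrtho_iff_inner_eq]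
  intro x hx y hy
  have hne : (μ : ℝ) ≠ ν := fun h => Set.disjoint_left.1 hst μ.2 (h ▸ ν.2)
  exact hT.orthogonalFamily_eigenspaces hne ⟨x, hx⟩ ⟨y, hy⟩

/-- A compact operator that is bounded below on a closed subspace forces it to be
finite-dimensional. -/
lemma finiteDimensional_of_isCompactOperator_of_le {T : H →L[ℝ] H} (hc : IsCompactOperator T)
    {F : Submodule ℝ H} [CompleteSpace F] {c : ℝ} (h0 : 0 < c)
    (hF : ∀ x ∈ F, c * ‖x‖ ≤ ‖T x‖) : FiniteDimensional ℝ F := by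
  have hanti : AntilipschitzWith (Real.toNNReal c⁻¹) (T.comp F.subtypeL) := by
    refine ContinuousLinearMap.antilipschitz_of_bound _ fun x => ?_
    rw [Real.coe_toNNReal _ (by positivity), inv_mul_eq_div, le_div_iff₀ h0, mul_comm]
    exact hF x x.2
  -- Being bounded below on a complete space, the restriction is a closed embedding, so the unit
  -- ball of `F` lies in the compact preimage of a compact set.
  have hemb := hanti.isClosedEmbedding (T.comp F.subtypeL).uniformContinuous
  have hc' : IsCompactOperator (T.comp F.subtypeL) := hc.comp_clm F.subtypeL
  obtain ⟨K, hK, hsub⟩ := hc'.image_closedBall_subset_compact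
    (f := (T.comp F.subtypeL : F →ₗ[ℝ] H)) 1
  refine FiniteDimensional.of_isCompact_closedBall ℝ (r := 1) one_pos (c := (0 : F)) ?_
  refine (hemb.isCompact_preimage hK).of_isClosed_subset Metric.isClosed_closedBall ?_
  exact Set.image_subset_iff.1 hsub

variable [CompleteSpace H]

/-- Cauchy–Schwarz turns the lower bound on the form into `c * ‖x‖ ≤ ‖T x‖`, a closed condition that
extends to the closure of the span, which is complete. -/
lemma finiteDimensional_eigenspan {T : H →L[ℝ] H} (hc : IsCompactOperator T)
    (hT : (T : H →ₗ[ℝ] H).IsSymmetric) {s : Set ℝ} {c : ℝ} (h0 : 0 < c) (hs : ∀ μ ∈ s, c ≤ μ) :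
    FiniteDimensional ℝ (eigenspan T s) := by
  set F := (eigenspan T s).topologicalClosure
  have hbd : ∀ x ∈ F, c * ‖x‖ ≤ ‖T x‖ := by
    have hcl : IsClosed {x : H | c * ‖x‖ ≤ ‖T x‖} :=
      isClosed_le (by fun_prop) (by fun_prop)
    intro x hx
    refine closure_minimal (fun y hy => ?_) hcl hx
    have h1 := le_inner_of_mem_eigenspan hT hs hy
    have h2 := real_inner_le_norm (T y) y
    rcases (norm_nonneg y).eq_or_lt with h | h
    · simp [← h]
    · refine le_of_mul_le_mul_right ?_ h
      nlinarith
  have : CompleteSpace F := (eigenspan T s).isClosed_topologicalClosure.completeSpace_coe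
  have := finiteDimensional_of_isCompactOperator_of_le hc h0 hbd
  exact Submodule.finiteDimensional_of_le (eigenspan T s).le_topologicalClosure

/-- By the spectral theorem the eigenspaces span a dense subspace, so the complement of those above
`t` is the closure of the span of the others, where the form is at most `t`. -/
lemma inner_le_of_mem_orthogonal_eigenspan {T : H →L[ℝ] H} (hc : IsCompactOperator T)
    (hT : (T : H →ₗ[ℝ] H).IsSymmetric) {t : ℝ} {x : H} (hx : x ∈ (eigenspan T (Set.Ioi t))ᗮ) :
    inner ℝ (T x) x ≤ t * ‖x‖ ^ 2 := by
  set G := (eigenspan T (Set.Iic t)).topologicalClosure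
  have : CompleteSpace G := Submodule.isClosed_topologicalClosure _ |>.completeSpace_coe
  have hort : eigenspan T (Set.Iic t) ≤ (eigenspan T (Set.Ioi t))ᗮ :=
    eigenspan_isOrtho hT (Set.Iic_disjoint_Ioi le_rfl)
  have hG : G ≤ (eigenspan T (Set.Ioi t))ᗮ :=
    Submodule.topologicalClosure_minimal _ hort (Submodule.isClosed_orthogonal _)
  have hxG : x ∈ G := by
    have h1 : x - G.starProjection x ∈ Gᗮ := G.sub_starProjection_mem_orthogonal x
    have h2 : x - G.starProjection x ∈ (eigenspan T (Set.Ioi t))ᗮ :=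
      Submodule.sub_mem _ hx (hG (G.starProjection_apply_mem x))
    -- The residual is orthogonal to eigenspaces up to `t` by projection, and to those above `t`
    -- because `x` and its projection both are.
    have h3 : x - G.starProjection x ∈ (⨆ μ, eigenspace (T : Module.End ℝ H) μ)ᗮ := by
      rw [← Submodule.iInf_orthogonal, Submodule.mem_iInf]
      intro μ
      rcases le_or_gt μ t with h | h
      · exact Submodule.orthogonal_le ((eigenspace_le_eigenspan T (s := Set.Iic t) h).trans
          (Submodule.le_topologicalClosure _)) h1
      · exact Submodule.orthogonal_le (eigenspace_le_eigenspan T (s := Set.Ioi t) h) h2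
    rw [ContinuousLinearMap.orthogonalComplement_iSup_eigenspaces_eq_bot hc hT,
      Submodule.mem_bot, sub_eq_zero] at h3
    rw [h3]
    exact G.starProjection_apply_mem x
  have hcl : IsClosed {x : H | inner ℝ (T x) x ≤ t * ‖x‖ ^ 2} :=
    isClosed_le (by fun_prop) (by fun_prop)
  exact closure_minimal (fun y hy => inner_le_of_mem_eigenspan hT (fun _ h => h) hy) hcl hxG

lemma finite_eigenvalues_gt {T : H →L[ℝ] H} (hc : IsCompactOperator T)
    (hT : (T : H →ₗ[ℝ] H).IsSymmetric) {t : ℝ} (ht : 0 < t) :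
    {μ : ℝ | t < μ ∧ eigenspace (T : Module.End ℝ H) μ ≠ ⊥}.Finite := by
  set s := {μ : ℝ | t < μ ∧ eigenspace (T : Module.End ℝ H) μ ≠ ⊥}
  have : FiniteDimensional ℝ (eigenspan T s) :=
    finiteDimensional_eigenspan hc hT ht fun μ hμ => hμ.1.le
  choose v hv hv0 using fun μ : s => (Submodule.ne_bot_iff _).1 μ.2.2
  have hli : LinearIndependent ℝ v :=
    eigenvectors_linearIndependent (T : Module.End ℝ H) s v fun μ => ⟨hv μ, hv0 μ⟩
  let w : s → eigenspan T s := fun μ => ⟨v μ, eigenspace_le_eigenspan T μ.2 (hv μ)⟩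
  have hw : LinearIndependent ℝ w := LinearIndependent.of_comp (eigenspan T s).subtype hli
  have := hw.finite
  exact Set.toFinite s


/-- The counting function `t ↦ dim eigenspan T (Ioi t)` jumps at `μ` by the multiplicity of `μ`; the
gap hypothesis says nothing else is crossed. -/
lemma finrank_eigenspan_Ioi {T : H →L[ℝ] H} (hc : IsCompactOperator T)
    (hT : (T : H →ₗ[ℝ] H).IsSymmetric) {t μ : ℝ} (ht : 0 < t) (htμ : t < μ)
    (h : ∀ ν, t < ν → ν < μ → eigenspace (T : Module.End ℝ H) ν = ⊥) :
    Module.finrank ℝ (eigenspan T (Set.Ioi t)) =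
      Module.finrank ℝ (eigenspan T (Set.Ioi μ)) +
        Module.finrank ℝ (eigenspace (T : Module.End ℝ H) μ) := by
  have hsup : eigenspan T (Set.Ioi t) =
      eigenspan T (Set.Ioi μ) ⊔ eigenspace (T : Module.End ℝ H) μ := by
    refine le_antisymm ?_ (sup_le (eigenspan_mono_of_ne_bot fun ν hν _ => htμ.trans hν)
      (eigenspace_le_eigenspan T htμ))
    rw [eigenspan_le_iff]
    intro ν hν
    rcases lt_trichotomy ν μ with h' | rfl | h'
    · simp [h ν hν h']
    · exact le_sup_right
    · exact (eigenspace_le_eigenspan T (s := Set.Ioi μ) h').trans le_sup_left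
  have hinf : eigenspan T (Set.Ioi μ) ⊓ eigenspace (T : Module.End ℝ H) μ = ⊥ := by
    have h1 : Disjoint (Set.Ioi μ) {μ} := by simp
    have h2 : Disjoint (eigenspan T (Set.Ioi μ)) (eigenspan T {μ}) :=
      (eigenspan_isOrtho hT h1).disjoint
    have h3 : eigenspace (T : Module.End ℝ H) μ ≤ eigenspan T {μ} :=
      eigenspace_le_eigenspan T (Set.mem_singleton μ)
    exact disjoint_iff.1 (h2.mono_right h3)
  have := finiteDimensional_eigenspan hc hT (s := Set.Ioi μ) (ht.trans htμ) fun _ h => le_of_lt h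
  have := ContinuousLinearMap.finite_dimensional_eigenspace hc μ (ht.trans htμ).ne'
  have key := Submodule.finrank_sup_add_finrank_inf_eq (eigenspan T (Set.Ioi μ))
    (eigenspace (T : Module.End ℝ H) μ)
  rwa [hinf, finrank_bot, add_zero, ← hsup] at key

end Spectral

/-! ### Max-min values: stability and identification with eigenvalues -/

section UpperEigenvalue

open Module.End

variable {H H' : Type*} [NormedAddCommGroup H] [InnerProductSpace ℝ H]
  [NormedAddCommGroup H'] [InnerProductSpace ℝ H']

/-- The set of `t ≥ 0` such that `t = 0` or the quadratic form of `T` is at least `t` on some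
subspace of dimension `i + 1`. -/
def formBounds (T : H →L[ℝ] H) (i : ℕ) : Set ℝ :=
  {t | t = 0 ∨ 0 < t ∧ ∃ S : Submodule ℝ H, Module.finrank ℝ S = i + 1 ∧
    ∀ x ∈ S, t * ‖x‖ ^ 2 ≤ inner ℝ (T x) x}

/-- The `i`-th largest positive eigenvalue of a compact symmetric operator (counted with
multiplicity, `0` if there are at most `i` of them), as a max-min of the quadratic form. -/
noncomputable def upperEigenvalue (T : H →L[ℝ] H) (i : ℕ) : ℝ := sSup (formBounds T i)

lemma zero_mem_formBounds (T : H →L[ℝ] H) (i : ℕ) : 0 ∈ formBounds T i := Or.inl rfl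

lemma bddAbove_formBounds (T : H →L[ℝ] H) (i : ℕ) : BddAbove (formBounds T i) := by
  refine ⟨‖T‖, ?_⟩
  rintro t (rfl | ⟨-, S, hS, hq⟩)
  · exact norm_nonneg _
  · have : FiniteDimensional ℝ S := FiniteDimensional.of_finrank_pos (by omega)
    obtain ⟨x, hx⟩ := (Module.finrank_pos_iff_exists_ne_zero (R := ℝ) (M := S)).1
      (by omega)
    have hx0 : 0 < ‖(x : H)‖ := norm_pos_iff.2 (by simpa using hx)
    have h1 := hq x x.2
    have h2 := real_inner_le_norm (T x) x
    have h3 := mul_le_mul_of_nonneg_right (T.le_opNorm x) hx0.le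
    refine le_of_mul_le_mul_right ?_ (pow_pos hx0 2)
    nlinarith

lemma upperEigenvalue_nonneg (T : H →L[ℝ] H) (i : ℕ) : 0 ≤ upperEigenvalue T i :=
  le_csSup (bddAbove_formBounds T i) (zero_mem_formBounds T i)

lemma lt_upperEigenvalue_iff {T : H →L[ℝ] H} {i : ℕ} {t : ℝ} (ht : 0 ≤ t) :
    t < upperEigenvalue T i ↔ ∃ t' > t, ∃ S : Submodule ℝ H, Module.finrank ℝ S = i + 1 ∧
      ∀ x ∈ S, t' * ‖x‖ ^ 2 ≤ inner ℝ (T x) x := by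
  rw [upperEigenvalue, lt_csSup_iff (bddAbove_formBounds T i) ⟨0, zero_mem_formBounds T i⟩]
  constructor
  · rintro ⟨t', rfl | ⟨h, hS⟩, htt'⟩
    · exact absurd htt' ht.not_gt
    · exact ⟨t', htt', hS⟩
  · rintro ⟨t', htt', hS⟩
    exact ⟨t', Or.inr ⟨ht.trans_lt htt', hS⟩, htt'⟩

/-- A contraction preserving the quadratic forms carries test subspaces to test subspaces:
positivity of the form makes it injective there, and shrinking norms only weakens the lower bound.
-/
lemma upperEigenvalue_le_of_forall {T : H →L[ℝ] H} {T' : H' →L[ℝ] H'} {i : ℕ} (L : H →ₗ[ℝ] H')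
    (hL : ∀ x, ‖L x‖ ≤ ‖x‖) (hform : ∀ x, inner ℝ (T' (L x)) (L x) = inner ℝ (T x) x) :
    upperEigenvalue T i ≤ upperEigenvalue T' i := by
  refine csSup_le_csSup (bddAbove_formBounds T' i) ⟨0, zero_mem_formBounds T i⟩ ?_
  rintro t (rfl | ⟨ht, S, hS, hq⟩)
  · exact zero_mem_formBounds T' i
  · refine Or.inr ⟨ht, S.map L, ?_, ?_⟩
    · have hinj : Function.Injective (L.domRestrict S) := by
        rw [injective_iff_map_eq_zero]
        intro x hx
        have hx' : L x = 0 := hx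
        have h1 := hq x x.2
        rw [← hform x, hx', inner_zero_right] at h1
        have h2 : ‖(x : H)‖ ^ 2 ≤ 0 := nonpos_of_mul_nonpos_right h1 ht
        have h3 : ‖(x : H)‖ = 0 := by nlinarith [norm_nonneg (x : H)]
        simpa using h3
      rw [← LinearMap.range_domRestrict, LinearMap.finrank_range_of_inj hinj, hS]
    · rintro _ ⟨x, hx, rfl⟩
      rw [hform x]
      refine le_trans ?_ (hq x hx)
      have := hL x
      gcongr

/-- Weyl's inequality: on the same test subspace the two forms differ by at most `‖T - T'‖ * ‖x‖ ^
2`. -/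
lemma upperEigenvalue_le_add_norm_sub (T T' : H →L[ℝ] H) (i : ℕ) :
    upperEigenvalue T i ≤ upperEigenvalue T' i + ‖T - T'‖ := by
  refine csSup_le ⟨0, zero_mem_formBounds T i⟩ ?_
  rintro t (rfl | ⟨ht, S, hS, hq⟩)
  · exact add_nonneg (upperEigenvalue_nonneg T' i) (norm_nonneg _)
  · rw [← sub_le_iff_le_add]
    rcases le_or_gt (t - ‖T - T'‖) 0 with h | h
    · exact h.trans (upperEigenvalue_nonneg T' i)
    · refine le_csSup (bddAbove_formBounds T' i) (Or.inr ⟨h, S, hS, fun x hx => ?_⟩)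
      have h1 := hq x hx
      have h2 := real_inner_le_norm ((T - T') x) x
      have h3 := mul_le_mul_of_nonneg_right ((T - T').le_opNorm x) (norm_nonneg x)
      rw [sub_apply, inner_sub_left] at h2
      rw [sub_apply] at h3
      nlinarith

lemma abs_upperEigenvalue_sub_le (T T' : H →L[ℝ] H) (i : ℕ) :
    |upperEigenvalue T i - upperEigenvalue T' i| ≤ ‖T - T'‖ := by
  have h1 := upperEigenvalue_le_add_norm_sub T T' i
  have h2 := upperEigenvalue_le_add_norm_sub T' T i
  rw [norm_sub_rev] at h2
  rw [abs_le]
  constructor <;> linarith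

variable [CompleteSpace H]

/-- Courant–Fischer as a count. A subspace with form at least `t' > t` meets the complement of
`eigenspan T (Ioi t)` only in `0`, hence projects injectively into that span; conversely any `i + 1`
independent vectors of the span give a test subspace. -/
lemma lt_upperEigenvalue_iff_lt_finrank {T : H →L[ℝ] H} (hc : IsCompactOperator T)
    (hT : (T : H →ₗ[ℝ] H).IsSymmetric) {i : ℕ} {t : ℝ} (ht : 0 < t) :
    t < upperEigenvalue T i ↔ i < Module.finrank ℝ (eigenspan T (Set.Ioi t)) := by
  have hfin := finiteDimensional_eigenspan hc hT (s := Set.Ioi t) ht fun _ h => le_of_lt h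
  rw [lt_upperEigenvalue_iff ht.le]
  constructor
  · rintro ⟨t', htt', S, hS, hq⟩
    have hinj : Function.Injective
        ((eigenspan T (Set.Ioi t)).orthogonalProjectionOnto.toLinearMap.domRestrict S) := by
      rw [injective_iff_map_eq_zero]
      intro x hx
      have hx' := inner_le_of_mem_orthogonal_eigenspan hc hT
        (Submodule.orthogonalProjectionOnto_eq_zero_iff.1 hx)
      have h1 := (hq x x.2).trans hx'
      by_contra hne
      have hx0 : 0 < ‖(x : H)‖ ^ 2 := pow_pos (norm_pos_iff.2 (by simpa using hne)) 2
      exact (not_le.2 htt') (le_of_mul_le_mul_right h1 hx0)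
    have := LinearMap.finrank_le_finrank_of_injective hinj
    omega
  · intro hi
    have hfinite := finite_eigenvalues_gt hc hT ht
    -- The form must be bounded by some `t'` strictly above `t`: the smallest eigenvalue above `t`
    -- serves, as there are finitely many; without any, `t + 1` serves vacuously.
    obtain ⟨t', htt', ht'⟩ : ∃ t' > t, ∀ μ, t < μ → eigenspace (T : Module.End ℝ H) μ ≠ ⊥ →
        t' ≤ μ := by
      rcases Set.eq_empty_or_nonempty
        {μ : ℝ | t < μ ∧ eigenspace (T : Module.End ℝ H) μ ≠ ⊥} with h | h
      · refine ⟨t + 1, by simp, fun μ h1 h2 => ?_⟩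
        exact absurd (show μ ∈ (∅ : Set ℝ) from h ▸ ⟨h1, h2⟩) (Set.notMem_empty μ)
      · obtain ⟨t', h1, h2⟩ := hfinite.exists_minimal h
        refine ⟨t', h1.1, fun μ h3 h4 => ?_⟩
        exact (le_total t' μ).elim id (h2 ⟨h3, h4⟩)
    have hle : eigenspan T (Set.Ioi t) ≤ eigenspan T (Set.Ici t') :=
      eigenspan_mono_of_ne_bot ht'
    let b := Module.finBasis ℝ (eigenspan T (Set.Ioi t))
    let v : Fin (i + 1) → H := fun j => b (Fin.castLE hi j)
    have hv : LinearIndependent ℝ v :=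
      (b.linearIndependent.comp _ (Fin.castLE_injective hi)).map'
        (eigenspan T (Set.Ioi t)).subtype (Submodule.ker_subtype _)
    refine ⟨t', htt', Submodule.span ℝ (Set.range v), ?_, fun x hx => ?_⟩
    · rw [finrank_span_eq_card hv, Fintype.card_fin]
    · have hsub : Submodule.span ℝ (Set.range v) ≤ eigenspan T (Set.Ioi t) := by
        rw [Submodule.span_le]
        rintro _ ⟨j, rfl⟩
        exact (b _).2
      exact le_inner_of_mem_eigenspan hT (s := Set.Ici t') (fun _ h => h) (hle (hsub hx))

lemma antitone_upperEigenvalue {T : H →L[ℝ] H} (hc : IsCompactOperator T)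
    (hT : (T : H →ₗ[ℝ] H).IsSymmetric) : Antitone (upperEigenvalue T) := by
  intro i j hij
  by_contra! h
  obtain ⟨t, h1, h2⟩ := exists_between h
  have ht : 0 < t := (upperEigenvalue_nonneg T i).trans_lt h1
  rw [lt_upperEigenvalue_iff_lt_finrank hc hT ht] at h2
  exact h1.not_gt ((lt_upperEigenvalue_iff_lt_finrank hc hT ht).2 (hij.trans_lt h2))

lemma tendsto_upperEigenvalue {T : H →L[ℝ] H} (hc : IsCompactOperator T)
    (hT : (T : H →ₗ[ℝ] H).IsSymmetric) : Tendsto (upperEigenvalue T) atTop (𝓝 0) := by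
  refine tendsto_order.2 ⟨fun t ht => Eventually.of_forall fun i =>
    ht.trans_le (upperEigenvalue_nonneg T i), fun t ht => ?_⟩
  filter_upwards [eventually_ge_atTop (Module.finrank ℝ (eigenspan T (Set.Ioi (t / 2))))]
    with i hi
  refine lt_of_le_of_lt (not_lt.1 fun h => ?_) (half_lt_self ht)
  exact hi.not_gt ((lt_upperEigenvalue_iff_lt_finrank hc hT (half_pos ht)).1 h)

/-- Pick `t < μ` with no eigenvalue strictly between. The indices of entries equal to `μ` then form
the interval between the counts above `μ` and above `t`, whose length is the multiplicity. -/
lemma ncard_upperEigenvalue_eq {T : H →L[ℝ] H} (hc : IsCompactOperator T)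
    (hT : (T : H →ₗ[ℝ] H).IsSymmetric) {μ : ℝ} (hμ : 0 < μ) :
    {i : ℕ | upperEigenvalue T i = μ}.ncard =
      Module.finrank ℝ (eigenspace (T : Module.End ℝ H) μ) := by
  obtain ⟨t, ht, htμ, hgap⟩ : ∃ t, 0 < t ∧ t < μ ∧
      ∀ ν, t < ν → ν < μ → eigenspace (T : Module.End ℝ H) ν = ⊥ := by
    have hfin : {ν : ℝ | (μ / 2 < ν ∧ eigenspace (T : Module.End ℝ H) ν ≠ ⊥) ∧ ν < μ}.Finite :=
      (finite_eigenvalues_gt hc hT (half_pos hμ)).subset fun ν h => h.1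
    rcases Set.eq_empty_or_nonempty
      {ν : ℝ | (μ / 2 < ν ∧ eigenspace (T : Module.End ℝ H) ν ≠ ⊥) ∧ ν < μ} with h | h
    · refine ⟨μ / 2, half_pos hμ, half_lt_self hμ, fun ν h1 h2 => ?_⟩
      by_contra h3
      exact (Set.notMem_empty ν) (h ▸ ⟨⟨h1, h3⟩, h2⟩)
    · obtain ⟨t, h1, h2⟩ := hfin.exists_maximal h
      refine ⟨t, (half_pos hμ).trans h1.1.1, h1.2, fun ν h3 h4 => ?_⟩
      by_contra h5
      exact h3.not_ge (h2 ⟨⟨h1.1.1.trans h3, h5⟩, h4⟩ h3.le)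
  have hset : {i : ℕ | upperEigenvalue T i = μ} =
      Finset.Ico (Module.finrank ℝ (eigenspan T (Set.Ioi μ)))
        (Module.finrank ℝ (eigenspan T (Set.Ioi t))) := by
    ext i
    rw [Finset.coe_Ico, Set.mem_Ico, ← not_lt, ← lt_upperEigenvalue_iff_lt_finrank hc hT hμ,
      not_lt]
    constructor
    · intro h
      have h : upperEigenvalue T i = μ := h
      exact ⟨h.le, (lt_upperEigenvalue_iff_lt_finrank hc hT ht).1 (h ▸ htμ)⟩
    · rintro ⟨h1, h2⟩
      refine le_antisymm h1 (le_of_forall_lt fun s hs => ?_)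
      rcases le_or_gt s t with hst | hst
      · exact hst.trans_lt ((lt_upperEigenvalue_iff_lt_finrank hc hT ht).2 h2)
      -- For `s` between `t` and `μ` the count above `s` equals the count above `t`, by the jump
      -- formula applied to both.
      · rw [lt_upperEigenvalue_iff_lt_finrank hc hT (ht.trans hst)]
        rwa [finrank_eigenspan_Ioi hc hT (ht.trans hst) hs fun ν h3 h4 => hgap ν (hst.trans h3) h4,
          ← finrank_eigenspan_Ioi hc hT ht htμ hgap]
  rw [hset, Set.ncard_coe_finset, Nat.card_Ico, finrank_eigenspan_Ioi hc hT ht htμ hgap,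
    Nat.add_sub_cancel_left]

end UpperEigenvalue

/-! ### Spectral enumerations of symmetric compact operators and of their reflections -/

section Enumeration

open Module.End

lemma eigenspace_neg_clm (T : L2 →L[ℝ] L2) (μ : ℝ) :
    eigenspace ((-T : L2 →L[ℝ] L2) : Module.End ℝ L2) (-μ) =
      eigenspace (T : Module.End ℝ L2) μ := by
  ext x
  simp

/-- The list below `0` is the negated upper list of `-T`, so only positive eigenvalues need study.
-/
lemma isSpectralEnumeration_upperEigenvalue {T : L2 →L[ℝ] L2} (hc : IsCompactOperator T)
    (hT : (T : L2 →ₗ[ℝ] L2).IsSymmetric) :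
    IsSpectralEnumeration T 0 (upperEigenvalue T) (fun i => -upperEigenvalue (-T) i) := by
  have hc' : IsCompactOperator (-T) := hc.neg
  have hT' : ((-T : L2 →L[ℝ] L2) : L2 →ₗ[ℝ] L2).IsSymmetric := by
    intro x y
    simpa using hT x y
  refine ⟨fun μ hμ h0 => (hc.hasEigenvalue_iff_mem_spectrum h0).2 hμ,
    fun μ h0 => ContinuousLinearMap.finite_dimensional_eigenspace hc μ h0,
    antitone_upperEigenvalue hc hT, tendsto_upperEigenvalue hc hT,
    (antitone_upperEigenvalue hc' hT').neg, ?_, fun μ hμ => ncard_upperEigenvalue_eq hc hT hμ,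
    fun μ hμ => ?_⟩
  · simpa using (tendsto_upperEigenvalue hc' hT').neg
  · have h := ncard_upperEigenvalue_eq hc' hT' (neg_pos.2 hμ)
    rw [eigenspace_neg_clm] at h
    simpa only [neg_eq_iff_eq_neg] using h

/-- The spectrum of `1 - e T e⁻¹` is enumerated by the reflected enumeration of that of `T`. -/
lemma IsSpectralEnumeration.one_sub_conj {T T' : L2 →L[ℝ] L2} {a b : ℕ → ℝ}
    (h : IsSpectralEnumeration T 0 a b) (e : L2 ≃L[ℝ] L2)
    (hT' : T' = ContinuousLinearMap.id ℝ L2 -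
      (e : L2 →L[ℝ] L2) ∘L T ∘L (e.symm : L2 →L[ℝ] L2)) :
    IsSpectralEnumeration T' 1 (fun i => 1 - b i) (fun i => 1 - a i) := by
  -- Since `T' e = e (1 - T)`, the map `e` carries the `(1 - μ)`-eigenspace of `T` onto the
  -- `μ`-eigenspace of `T'`; the reflection swaps the two lists.
  have hmem : ∀ μ x, e x ∈ eigenspace (T' : Module.End ℝ L2) μ ↔
      x ∈ eigenspace (T : Module.End ℝ L2) (1 - μ) := by
    intro μ x
    have hx : T' (e x) = e (x - T x) := by simp [hT']
    rw [mem_eigenspace_iff, mem_eigenspace_iff, ContinuousLinearMap.coe_coe,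
      ContinuousLinearMap.coe_coe, hx, ← map_smul, e.injective.eq_iff, sub_smul, one_smul]
    constructor
    · intro h
      rw [← h]; abel
    · intro h
      rw [h]; abel
  have hmap : ∀ μ, eigenspace (T' : Module.End ℝ L2) μ =
      (eigenspace (T : Module.End ℝ L2) (1 - μ)).map (e.toLinearEquiv : L2 →ₗ[ℝ] L2) := by
    intro μ
    ext y
    rw [Submodule.mem_map]
    constructor
    · intro hy
      exact ⟨e.symm y, (hmem μ _).1 (by simpa using hy), by simp⟩
    · rintro ⟨x, hx, rfl⟩
      exact (hmem μ x).2 hx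
  have hrank : ∀ μ, Module.finrank ℝ (eigenspace (T' : Module.End ℝ L2) μ) =
      Module.finrank ℝ (eigenspace (T : Module.End ℝ L2) (1 - μ)) := by
    intro μ
    rw [hmap μ]
    exact LinearEquiv.finrank_map_eq e.toLinearEquiv _
  have hspec : ∀ μ ∈ spectrum ℝ T', 1 - μ ∈ spectrum ℝ T := by
    intro μ hμ
    have h1 : T' = algebraMap ℝ (L2 →L[ℝ] L2) 1 -
        (e.toUnit : L2 →L[ℝ] L2) * T * ((e.toUnit⁻¹ : (L2 →L[ℝ] L2)ˣ) : L2 →L[ℝ] L2) := by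
      rw [hT', map_one]
      rfl
    rw [h1, ← spectrum.singleton_sub_eq, spectrum.units_conjugate, Set.mem_sub] at hμ
    obtain ⟨c, hc, d, hd, rfl⟩ := hμ
    rw [Set.mem_singleton_iff.1 hc]
    simpa using hd
  refine ⟨fun μ hμ h1 => ?_, fun μ h1 => ?_, fun i j hij => ?_, ?_, fun i j hij => ?_, ?_,
    fun μ hμ => ?_, fun μ hμ => ?_⟩
  · have h2 := h.hasEigenvalue _ (hspec μ hμ) (sub_ne_zero.2 (Ne.symm h1))
    obtain ⟨x, hx, hx0⟩ := h2.exists_hasEigenvector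
    exact hasEigenvalue_of_hasEigenvector (x := e x) ⟨(hmem μ x).2 hx, by simpa using hx0⟩
  · have := h.finiteDimensional (1 - μ) (sub_ne_zero.2 (Ne.symm h1))
    rw [hmap μ]
    infer_instance
  · exact sub_le_sub_left (h.monotone hij) 1
  · simpa using h.tendsto_below.const_sub 1
  · exact sub_le_sub_left (h.antitone hij) 1
  · simpa using h.tendsto_above.const_sub 1
  · rw [hrank, ← h.card_below (1 - μ) (by linarith)]
    congr 1
    ext i
    exact ⟨fun hi => by simp only [Set.mem_ofPred_eq] at hi ⊢; linarith,
      fun hi => by simp only [Set.mem_ofPred_eq] at hi ⊢; linarith⟩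
  · rw [hrank, ← h.card_above (1 - μ) (by linarith)]
    congr 1
    ext i
    exact ⟨fun hi => by simp only [Set.mem_ofPred_eq] at hi ⊢; linarith,
      fun hi => by simp only [Set.mem_ofPred_eq] at hi ⊢; linarith⟩

end Enumeration

/-! ### Kernel operators -/

section KernelOp

lemma kernelOp_congr {K K' : I → I → ℝ} (hK : SquareIntegrable K) (hK' : SquareIntegrable K')
    (h : Function.uncurry K =ᵐ[volume] Function.uncurry K') : kernelOp K hK = kernelOp K' hK' := by
  ext1 f
  refine Lp.ext ?_
  have h' : ∀ᵐ x : I, ∀ᵐ y : I, K x y = K' x y := Measure.ae_ae_of_ae_prod h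
  filter_upwards [kernelOp_ae_eq K hK f, kernelOp_ae_eq K' hK' f, h'] with x h1 h2 h3
  rw [h1, h2]
  refine integral_congr_ae ?_
  filter_upwards [h3] with y hy
  rw [hy]

lemma kernelOp_add {K K' : I → I → ℝ} (hK : SquareIntegrable K) (hK' : SquareIntegrable K')
    (hadd : SquareIntegrable fun x y => K x y + K' x y) :
    kernelOp _ hadd = kernelOp K hK + kernelOp K' hK' := by
  ext1 f
  refine Lp.ext ?_
  filter_upwards [kernelOp_ae_eq K hK f, kernelOp_ae_eq K' hK' f, kernelOp_ae_eq _ hadd f,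
    Lp.coeFn_add (kernelOp K hK f) (kernelOp K' hK' f), hK.ae_integrable_mul f,
    hK'.ae_integrable_mul f] with x h1 h2 h3 h4 h5 h6
  rw [add_apply, h4, Pi.add_apply, h1, h2, h3, ← integral_add h5 h6]
  simp only [add_mul]

lemma kernelOp_sub {K K' : I → I → ℝ} (hK : SquareIntegrable K) (hK' : SquareIntegrable K')
    (hsub : SquareIntegrable fun x y => K x y - K' x y) :
    kernelOp _ hsub = kernelOp K hK - kernelOp K' hK' := by
  rw [eq_sub_iff_add_eq, ← kernelOp_add hsub hK' (by simpa using hK)]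
  exact kernelOp_congr _ _ (Eventually.of_forall fun p => by simp [Function.uncurry])

lemma kernelOp_smul {K : I → I → ℝ} (hK : SquareIntegrable K) (c : ℝ)
    (hc : SquareIntegrable fun x y => c * K x y) :
    kernelOp _ hc = c • kernelOp K hK := by
  ext1 f
  refine Lp.ext ?_
  filter_upwards [kernelOp_ae_eq K hK f, kernelOp_ae_eq _ hc f,
    Lp.coeFn_smul c (kernelOp K hK f)] with x h1 h2 h3
  rw [smul_apply, h3, Pi.smul_apply, h1, h2, smul_eq_mul, ← integral_const_mul]
  simp only [mul_assoc]

lemma norm_kernelOp_le (K : I → I → ℝ) (hK : SquareIntegrable K) :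
    ‖kernelOp K hK‖ ≤ (eLpNorm (Function.uncurry K) 2 volume).toReal :=
  LinearMap.mkContinuous_norm_le _ ENNReal.toReal_nonneg _

lemma squareIntegrable_coeFn (F : Lp ℝ 2 (volume : Measure (I × I))) :
    SquareIntegrable fun x y => F (x, y) := Lp.memLp F

/-- The kernel operator as a continuous linear function of its kernel. -/
noncomputable def kernelOpL : Lp ℝ 2 (volume : Measure (I × I)) →L[ℝ] (L2 →L[ℝ] L2) :=
  LinearMap.mkContinuous
    { toFun := fun F => kernelOp (fun x y => F (x, y)) (squareIntegrable_coeFn F)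
      map_add' := fun F G => by
        rw [← kernelOp_add (squareIntegrable_coeFn F) (squareIntegrable_coeFn G)
          ((Lp.memLp F).add (Lp.memLp G))]
        exact kernelOp_congr _ _ (Lp.coeFn_add F G)
      map_smul' := fun c F => by
        rw [RingHom.id_apply, ← kernelOp_smul (squareIntegrable_coeFn F) c
          ((Lp.memLp F).const_mul c)]
        exact kernelOp_congr _ _ (Lp.coeFn_smul c F) }
    1 (fun F => by
      rw [one_mul, Lp.norm_def]
      exact norm_kernelOp_le _ (squareIntegrable_coeFn F))

lemma kernelOpL_toLp {K : I → I → ℝ} (hK : SquareIntegrable K) :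
    kernelOpL (hK.toLp _) = kernelOp K hK :=
  kernelOp_congr (squareIntegrable_coeFn _) hK hK.coeFn_toLp

/-- A product kernel gives the rank-one operator `f ↦ ⟨w, f⟩ u`. -/
lemma isCompactOperator_kernelOp_mul {u w : I → ℝ} (hu : MemLp u 2 volume) (hw : MemLp w 2 volume)
    (h : SquareIntegrable fun x y => u x * w y) :
    IsCompactOperator (kernelOp (fun x y => u x * w y) h) := by
  have heq : kernelOp (fun x y => u x * w y) h =
      (ContinuousLinearMap.toSpanSingleton ℝ (hu.toLp u)) ∘L (innerSL ℝ (hw.toLp w)) := by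
    ext1 f
    refine Lp.ext ?_
    have hin : (innerSL ℝ (hw.toLp w)) f = ∫ y, w y * f y := by
      rw [innerSL_apply_apply, L2.inner_def]
      refine integral_congr_ae ?_
      filter_upwards [hw.coeFn_toLp] with y hy
      rw [hy]
      simp [mul_comm]
    rw [ContinuousLinearMap.comp_apply, hin, ContinuousLinearMap.toSpanSingleton_apply]
    filter_upwards [kernelOp_ae_eq _ h f, hu.coeFn_toLp,
      Lp.coeFn_smul (∫ y, w y * f y) (hu.toLp u)] with x h1 h2 h3
    rw [h1, h3, Pi.smul_apply, h2, smul_eq_mul, mul_comm, ← integral_const_mul]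
    simp only [mul_assoc]
  have hc : IsCompactOperator (ContinuousLinearMap.toSpanSingleton ℝ (hu.toLp u)) :=
    isCompactOperator_of_locallyCompactSpace_rng _
  rw [heq]
  exact hc.comp_clm _

/-- A Hilbert–Schmidt operator is compact. -/
lemma isCompactOperator_kernelOp {K : I → I → ℝ} (hK : SquareIntegrable K) :
    IsCompactOperator (kernelOp K hK) := by
  -- Kernels with compact operator form a closed subspace containing indicators of rectangles. A
  -- kernel orthogonal to it integrates to `0` over rectangles, hence over all measurable sets by
  -- the π-λ theorem, so it vanishes.
  let M : Submodule ℝ (Lp ℝ 2 (volume : Measure (I × I))) :=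
    (compactOperator (RingHom.id ℝ) L2 L2).comap kernelOpL.toLinearMap
  have hMcl : IsClosed (M : Set (Lp ℝ 2 (volume : Measure (I × I)))) :=
    isClosed_setOfPred_isCompactOperator.preimage kernelOpL.continuous
  have := hMcl.completeSpace_coe
  have hbot : Mᗮ = ⊥ := by
    rw [Submodule.eq_bot_iff]
    intro F hF
    have hFint : Integrable F volume := (Lp.memLp F).integrable one_le_two
    have hrect : ∀ A B : Set I, MeasurableSet A → MeasurableSet B →
        ∫ p in A ×ˢ B, F p = 0 := by
      intro A B hA hB
      rw [← L2.inner_indicatorConstLp_one (hA.prod hB) (measure_ne_top _ _)]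
      refine hF _ ?_
      change IsCompactOperator (kernelOpL _)
      have hu : MemLp (A.indicator fun _ => (1 : ℝ)) 2 (volume : Measure I) :=
        memLp_indicator_const 2 hA 1 (Or.inr (measure_ne_top _ _))
      have hw : MemLp (B.indicator fun _ => (1 : ℝ)) 2 (volume : Measure I) :=
        memLp_indicator_const 2 hB 1 (Or.inr (measure_ne_top _ _))
      have hfun : Function.uncurry (fun x y => A.indicator (fun _ => (1 : ℝ)) x *
          B.indicator (fun _ => (1 : ℝ)) y) = (A ×ˢ B).indicator fun _ => (1 : ℝ) := by
        ext ⟨x, y⟩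
        by_cases hx : x ∈ A <;> by_cases hy : y ∈ B <;> simp [hx, hy]
      have huw : SquareIntegrable fun x y => A.indicator (fun _ => (1 : ℝ)) x *
          B.indicator (fun _ => (1 : ℝ)) y := by
        rw [SquareIntegrable, hfun]
        exact memLp_indicator_const 2 (hA.prod hB) 1 (Or.inr (measure_ne_top _ _))
      have hop := isCompactOperator_kernelOp_mul hu hw huw
      convert hop using 2
      refine kernelOp_congr (squareIntegrable_coeFn _) huw ?_
      rw [hfun]
      exact indicatorConstLp_coeFn
    have hset : ∀ s, MeasurableSet s → ∫ p in s, F p = 0 := by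
      refine MeasurableSpace.induction_on_inter generateFrom_prod.symm isPiSystem_prod
        (by simp) ?_ ?_ ?_
      · rintro _ ⟨A, hA, B, hB, rfl⟩
        exact hrect A B hA hB
      · intro t ht h
        have huniv := hrect Set.univ Set.univ .univ .univ
        rw [Set.univ_prod_univ, setIntegral_univ] at huniv
        have := integral_add_compl ht hFint
        rwa [h, huniv, zero_add] at this
      · intro f hd hm h
        rw [integral_iUnion hm hd hFint.integrableOn]
        simp [h]
    have h0 := hFint.ae_eq_zero_of_forall_setIntegral_eq_zero fun s hs _ => hset s hs
    exact (Lp.eq_zero_iff_ae_eq_zero).2 h0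
  have htop : M = ⊤ := M.orthogonal_eq_bot_iff.1 hbot
  have hmem : hK.toLp _ ∈ M := htop ▸ Submodule.mem_top
  have hmem' : IsCompactOperator (kernelOpL (hK.toLp _)) := hmem
  rwa [kernelOpL_toLp] at hmem'

lemma SquareIntegrable.integrable_form {K : I → I → ℝ} (hK : SquareIntegrable K) {f g : I → ℝ}
    (hf : MemLp f 2 volume) (hg : MemLp g 2 volume) :
    Integrable (fun p : I × I => K p.1 p.2 * f p.1 * g p.2) := by
  have hfg : MemLp (fun p : I × I => f p.1 * g p.2) 2 volume := by
    have hm : AEStronglyMeasurable (fun p : I × I => f p.1 * g p.2) (volume.prod volume) :=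
      hf.aestronglyMeasurable.comp_fst.mul hg.aestronglyMeasurable.comp_snd
    refine (memLp_two_iff_integrable_sq hm).2 ?_
    simpa only [mul_pow] using hf.integrable_sq.mul_prod hg.integrable_sq
  simpa only [mul_assoc] using! hK.integrable_mul hfg

lemma inner_kernelOp {K : I → I → ℝ} (hK : SquareIntegrable K) (f g : L2) :
    inner ℝ (kernelOp K hK f) g = ∫ p : I × I, K p.1 p.2 * g p.1 * f p.2 := by
  have hint := hK.integrable_form (Lp.memLp g) (Lp.memLp f)
  rw [L2.inner_def]
  refine Eq.trans ?_ (integral_prod _ hint).symm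
  refine integral_congr_ae ?_
  filter_upwards [kernelOp_ae_eq K hK f] with x hx
  rw [hx]
  simp only [RCLike.inner_apply, conj_trivial]
  rw [← integral_const_mul]
  exact integral_congr_ae (Eventually.of_forall fun y => by ring)

lemma isSymmetric_kernelOp {K : I → I → ℝ} (hK : SquareIntegrable K)
    (hsymm : ∀ x y, K x y = K y x) : (kernelOp K hK : L2 →ₗ[ℝ] L2).IsSymmetric := by
  intro f g
  rw [ContinuousLinearMap.coe_coe, inner_kernelOp, real_inner_comm, inner_kernelOp]
  have h := (Measure.measurePreserving_swap (μ := (volume : Measure I))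
    (ν := (volume : Measure I))).integral_comp (MeasurableEquiv.prodComm.measurableEmbedding)
    (fun p : I × I => K p.1 p.2 * f p.1 * g p.2)
  refine Eq.trans ?_ h
  refine integral_congr_ae (Eventually.of_forall fun p => ?_)
  simp only [Prod.fst_swap, Prod.snd_swap]
  rw [hsymm p.2 p.1]
  ring

end KernelOp

/-! ### Bounded kernels: cut norm and operator norm -/

section CutNorm

/-- A measurable kernel bounded by `B`. -/
structure IsBoundedKernel (K : I → I → ℝ) (B : ℝ) : Prop where
  measurable : Measurable (Function.uncurry K)
  abs_le : ∀ x y, |K x y| ≤ B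

namespace IsBoundedKernel

variable {K K' : I → I → ℝ} {B B' : ℝ}

lemma nonneg (hK : IsBoundedKernel K B) : 0 ≤ B := (abs_nonneg _).trans (hK.abs_le 0 0)

lemma squareIntegrable (hK : IsBoundedKernel K B) : SquareIntegrable K :=
  MemLp.of_bound hK.measurable.aestronglyMeasurable B
    (Eventually.of_forall fun p => hK.abs_le p.1 p.2)

lemma sub (hK : IsBoundedKernel K B) (hK' : IsBoundedKernel K' B') :
    IsBoundedKernel (fun x y => K x y - K' x y) (B + B') :=
  ⟨hK.measurable.sub hK'.measurable,
    fun x y => (abs_sub _ _).trans (add_le_add (hK.abs_le x y) (hK'.abs_le x y))⟩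

lemma comp (hK : IsBoundedKernel K B) {φ : I → I} (hφ : Measurable φ) :
    IsBoundedKernel (fun x y => K (φ x) (φ y)) B :=
  ⟨hK.measurable.comp ((hφ.comp measurable_fst).prodMk (hφ.comp measurable_snd)),
    fun _ _ => hK.abs_le _ _⟩

lemma integrable_form (hK : IsBoundedKernel K B) {f g : I → ℝ} (hf : Integrable f)
    (hg : Integrable g) : Integrable (fun p : I × I => K p.1 p.2 * f p.1 * g p.2) := by
  have h := (hf.mul_prod hg).bdd_mul (c := B) hK.measurable.aestronglyMeasurable
    (Eventually.of_forall fun p => hK.abs_le p.1 p.2)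
  simpa only [mul_assoc, Function.uncurry] using! h

lemma abs_form_le (hK : IsBoundedKernel K B) {f g : I → ℝ} (hf : Integrable f)
    (hg : Integrable g) :
    |∫ p : I × I, K p.1 p.2 * f p.1 * g p.2| ≤ B * ((∫ x, |f x|) * ∫ y, |g y|) := by
  have h1 : |∫ p : I × I, K p.1 p.2 * f p.1 * g p.2| ≤
      ∫ p : I × I, B * (|f p.1| * |g p.2|) := by
    refine norm_integral_le_of_norm_le (f := fun p : I × I => K p.1 p.2 * f p.1 * g p.2)
      ((hf.abs.mul_prod hg.abs).const_mul B)
      (Eventually.of_forall fun p => ?_)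
    rw [Real.norm_eq_abs, abs_mul, abs_mul, mul_assoc]
    exact mul_le_mul_of_nonneg_right (hK.abs_le _ _) (by positivity)
  rw [integral_const_mul] at h1
  exact h1.trans_eq (congrArg (B * ·)
    (integral_prod_mul (μ := (volume : Measure I)) (ν := (volume : Measure I))
      (fun x => |f x|) (fun y => |g y|)))

lemma integral_form_add_add (hK : IsBoundedKernel K B) {f₁ f₂ g₁ g₂ : I → ℝ}
    (hf₁ : Integrable f₁) (hf₂ : Integrable f₂) (hg₁ : Integrable g₁) (hg₂ : Integrable g₂) :
    ∫ p : I × I, K p.1 p.2 * (f₁ p.1 + f₂ p.1) * (g₁ p.2 + g₂ p.2) =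
      (∫ p : I × I, K p.1 p.2 * f₁ p.1 * g₁ p.2) + (∫ p : I × I, K p.1 p.2 * f₁ p.1 * g₂ p.2) +
      ((∫ p : I × I, K p.1 p.2 * f₂ p.1 * g₁ p.2) +
        ∫ p : I × I, K p.1 p.2 * f₂ p.1 * g₂ p.2) := by
  have h11 := hK.integrable_form hf₁ hg₁
  have h12 := hK.integrable_form hf₁ hg₂
  have h21 := hK.integrable_form hf₂ hg₁
  have h22 := hK.integrable_form hf₂ hg₂
  rw [← integral_add h11 h12, ← integral_add h21 h22]
  refine Eq.trans ?_ (integral_add (h11.add h12) (h21.add h22))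
  refine integral_congr_ae (Eventually.of_forall fun p => ?_)
  simp only
  ring

end IsBoundedKernel

lemma integrable_of_abs_le {f : I → ℝ} (hf : Measurable f) {c : ℝ} (hc : ∀ x, |f x| ≤ c) :
    Integrable f :=
  Integrable.of_bound hf.aestronglyMeasurable c (Eventually.of_forall hc)

lemma integral_abs_le_of_abs_le {f : I → ℝ} {c : ℝ} (hc : ∀ x, |f x| ≤ c) :
    ∫ x, |f x| ≤ c := by
  have h := norm_integral_le_of_norm_le_const (μ := (volume : Measure I)) (f := fun x => |f x|)
    (C := c) (Eventually.of_forall fun x => by simpa using hc x)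
  simpa using (le_abs_self _).trans h

lemma TestFun.integrable (f : TestFun) : Integrable (fun x => (f.1 x : ℝ)) :=
  integrable_of_abs_le (measurable_subtype_coe.comp f.2) (c := 1) fun x => by
    rw [abs_of_nonneg (f.1 x).2.1]; exact (f.1 x).2.2

lemma TestFun.integral_abs_le (f : TestFun) : ∫ x, |(f.1 x : ℝ)| ≤ 1 :=
  integral_abs_le_of_abs_le fun x => by
    rw [abs_of_nonneg (f.1 x).2.1]; exact (f.1 x).2.2

/-- Boundedness of the kernel is essential: a real `⨆` over an unbounded family has the default
value `0`. -/
lemma IsBoundedKernel.le_cutNorm {K : I → I → ℝ} {B : ℝ} (hK : IsBoundedKernel K B)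
    (f g : TestFun) :
    |∫ p : I × I, K p.1 p.2 * (f.1 p.1 : ℝ) * (g.1 p.2 : ℝ)| ≤ cutNorm K := by
  refine le_ciSup (f := fun fg : TestFun × TestFun =>
    |∫ p : I × I, K p.1 p.2 * (fg.1.1 p.1 : ℝ) * (fg.2.1 p.2 : ℝ)|) ⟨B, ?_⟩ (f, g)
  rintro _ ⟨⟨f, g⟩, rfl⟩
  refine (hK.abs_form_le f.integrable g.integrable).trans ?_
  refine mul_le_of_le_one_right hK.nonneg ?_
  exact mul_le_one₀ f.integral_abs_le (integral_nonneg fun _ => abs_nonneg _) g.integral_abs_le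

/-- A measurable function with values in `[-1,1]` is a difference of test functions. -/
lemma exists_testFun_sub {f : I → ℝ} (hf : Measurable f) (h1 : ∀ x, |f x| ≤ 1) :
    ∃ f₁ f₂ : TestFun, ∀ x, f x = (f₁.1 x : ℝ) - (f₂.1 x : ℝ) := by
  -- Clipping `f` and `-f` to `[0,1]` yields the positive and negative parts.
  refine ⟨⟨fun x => Set.projIcc 0 1 zero_le_one (f x), ?_⟩,
    ⟨fun x => Set.projIcc 0 1 zero_le_one (-f x), ?_⟩, fun x => ?_⟩
  · exact continuous_projIcc.measurable.comp hf
  · exact continuous_projIcc.measurable.comp hf.neg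
  · have := abs_le.1 (h1 x)
    simp only [Set.coe_projIcc]
    rcases le_total 0 (f x) with h | h
    · rw [min_eq_right this.2, max_eq_right h, min_eq_right (by linarith), max_eq_left (by linarith)]
      ring
    · rw [min_eq_right this.2, max_eq_left h, min_eq_right (by linarith),
        max_eq_right (by linarith)]
      ring

/-- Splitting both functions into positive and negative parts gives four test pairs, hence the
factor `4`. -/
lemma abs_form_le_cutNorm {K : I → I → ℝ} {B : ℝ} (hK : IsBoundedKernel K B)
    {f g : I → ℝ} (hf : Measurable f) (hg : Measurable g) (hf1 : ∀ x, |f x| ≤ 1)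
    (hg1 : ∀ x, |g x| ≤ 1) :
    |∫ p : I × I, K p.1 p.2 * f p.1 * g p.2| ≤ 4 * cutNorm K := by
  obtain ⟨f₁, f₂, hf'⟩ := exists_testFun_sub hf hf1
  obtain ⟨g₁, g₂, hg'⟩ := exists_testFun_sub hg hg1
  have heq := hK.integral_form_add_add f₁.integrable f₂.integrable.neg g₁.integrable
    g₂.integrable.neg
  simp only [Pi.neg_apply, ← sub_eq_add_neg, ← hf', ← hg', mul_neg, neg_mul, integral_neg,
    neg_neg] at heq
  have hle := fun u v : TestFun => abs_le.1 (hK.le_cutNorm u v)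
  rw [heq, abs_le]
  have h11 := hle f₁ g₁
  have h12 := hle f₁ g₂
  have h21 := hle f₂ g₁
  have h22 := hle f₂ g₂
  constructor <;> linarith

/-- Truncation at level `M` splits a unit vector of `L²` into a part bounded by `M` and a part of
`L¹` norm at most `1 / M`. -/
lemma exists_truncation (f : L2) (hf : ‖f‖ = 1) {M : ℝ} (hM : 0 < M) :
    ∃ f₁ f₂ : I → ℝ, (∀ x, f x = f₁ x + f₂ x) ∧ Measurable f₁ ∧ (∀ x, |f₁ x| ≤ M) ∧
      (∫ x, |f₁ x| ≤ 1) ∧ Integrable f₂ ∧ (∫ x, |f₂ x| ≤ 1 / M) := by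
  have hm : Measurable f := (Lp.stronglyMeasurable f).measurable
  have hsq : Integrable (fun x => f x ^ 2) := (Lp.memLp f).integrable_sq
  have hsq1 : ∫ x, f x ^ 2 = 1 := by
    have h := real_inner_self_eq_norm_sq f
    rw [hf, L2.inner_def] at h
    simpa [pow_two] using h
  have hs : MeasurableSet {x | |f x| ≤ M} := measurableSet_le hm.abs measurable_const
  have hint : Integrable f := (Lp.memLp f).integrable one_le_two
  refine ⟨{x | |f x| ≤ M}.indicator f, {x | |f x| ≤ M}ᶜ.indicator f, fun x => ?_,
    hm.indicator hs, fun x => ?_, ?_, hint.indicator hs.compl, ?_⟩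
  · exact (congrFun (Set.indicator_self_add_compl _ f) x).symm
  · by_cases hx : |f x| ≤ M
    · rwa [Set.indicator_of_mem (show x ∈ {x | |f x| ≤ M} from hx)]
    · rw [Set.indicator_of_notMem (show x ∉ {x | |f x| ≤ M} from hx), abs_zero]
      exact hM.le
  -- Uses `|f| ≤ (1 + f²) / 2` on a probability space.
  · calc ∫ x, |{x | |f x| ≤ M}.indicator (f : I → ℝ) x|
        ≤ ∫ x, (1 / 2) * (1 + f x ^ 2) := by
          refine integral_mono_of_nonneg (Eventually.of_forall fun x => abs_nonneg _)
            (((integrable_const 1).add hsq).const_mul _) (Eventually.of_forall fun x => ?_)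
          have h1 : |{x | |f x| ≤ M}.indicator (f : I → ℝ) x| ≤ |f x| :=
            norm_indicator_le_norm_self (f : I → ℝ) x
          have h2 := sq_nonneg (|f x| - 1)
          have h3 := sq_abs (f x)
          simp only
          nlinarith
      _ = 1 := by
          rw [integral_const_mul, integral_add (integrable_const 1) hsq, hsq1]
          simp; norm_num
  -- Where `|f| > M`, one has `|f| ≤ f² / M`.
  · calc ∫ x, |{x | |f x| ≤ M}ᶜ.indicator (f : I → ℝ) x|
        ≤ ∫ x, (1 / M) * f x ^ 2 := by
          refine integral_mono_of_nonneg (Eventually.of_forall fun x => abs_nonneg _)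
            (hsq.const_mul _) (Eventually.of_forall fun x => ?_)
          simp only
          by_cases hx : |f x| ≤ M
          · rw [Set.indicator_of_notMem (by simpa using hx), abs_zero]
            positivity
          · rw [Set.indicator_of_mem (by simpa using hx), ← sq_abs (f x), one_div,
              ← div_eq_inv_mul, le_div_iff₀ hM]
            nlinarith [abs_nonneg (f x)]
      _ = 1 / M := by rw [integral_const_mul, hsq1, mul_one]

/-- The operator norm of a bounded kernel is controlled by its bilinear form on bounded
functions. -/
lemma IsBoundedKernel.norm_kernelOp_le {K : I → I → ℝ} {B : ℝ} (hK : IsBoundedKernel K B)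
    {δ : ℝ} (hδ0 : 0 ≤ δ)
    (hδ : ∀ f g : I → ℝ, Measurable f → Measurable g → (∀ x, |f x| ≤ 1) → (∀ x, |g x| ≤ 1) →
      |∫ p : I × I, K p.1 p.2 * f p.1 * g p.2| ≤ δ) {M : ℝ} (hM : 1 ≤ M) :
    ‖kernelOp K hK.squareIntegrable‖ ≤ M ^ 2 * δ + 3 * B / M := by
  have hB := hK.nonneg
  have hM0 : 0 < M := one_pos.trans_le hM
  have hnn : ∀ u : I → ℝ, 0 ≤ ∫ x, |u x| := fun u => integral_nonneg fun _ => abs_nonneg _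
  have key : ∀ f g : L2, ‖f‖ = 1 → ‖g‖ = 1 →
      inner ℝ (kernelOp K hK.squareIntegrable f) g ≤ M ^ 2 * δ + 3 * B / M := by
    intro f g hf hg
    obtain ⟨f₁, f₂, hfe, hf₁m, hf₁M, hf₁, hf₂i, hf₂⟩ := exists_truncation f hf hM0
    obtain ⟨g₁, g₂, hge, hg₁m, hg₁M, hg₁, hg₂i, hg₂⟩ := exists_truncation g hg hM0
    have hf₁i := integrable_of_abs_le hf₁m hf₁M
    have hg₁i := integrable_of_abs_le hg₁m hg₁M
    rw [inner_kernelOp]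
    simp only [hfe, hge]
    rw [hK.integral_form_add_add hg₁i hg₂i hf₁i hf₂i]
    have hdiv : ∀ u : I → ℝ, (∀ x, |u x| ≤ M) → ∀ x, |u x / M| ≤ 1 := by
      intro u hu x
      rw [abs_div, abs_of_pos hM0]
      exact div_le_one_of_le₀ (hu x) hM0.le
    -- The bounded parts become admissible after division by `M`, at the cost of `M ^ 2`. The three
    -- terms below contain a factor of `L¹` norm at most `1 / M`, so each costs at most `B / M`.
    have h11 : ∫ p : I × I, K p.1 p.2 * g₁ p.1 * f₁ p.2 ≤ M ^ 2 * δ := by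
      have h := (le_abs_self _).trans (hδ (fun x => g₁ x / M) (fun x => f₁ x / M)
        (hg₁m.div_const M) (hf₁m.div_const M) (hdiv g₁ hg₁M) (hdiv f₁ hf₁M))
      have heq : ∫ p : I × I, K p.1 p.2 * g₁ p.1 * f₁ p.2 =
          M ^ 2 * ∫ p : I × I, K p.1 p.2 * (g₁ p.1 / M) * (f₁ p.2 / M) := by
        rw [← integral_const_mul]
        refine integral_congr_ae (Eventually.of_forall fun p => ?_)
        simp only
        field_simp
      rw [heq]
      gcongr
    have h12 := (le_abs_self _).trans (hK.abs_form_le hg₁i hf₂i)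
    have h21 := (le_abs_self _).trans (hK.abs_form_le hg₂i hf₁i)
    have h22 := (le_abs_self _).trans (hK.abs_form_le hg₂i hf₂i)
    have hM1 : 1 / M ≤ 1 := by rwa [div_le_one hM0]
    have h12' : (∫ x, |g₁ x|) * ∫ x, |f₂ x| ≤ 1 / M := by
      simpa using mul_le_mul hg₁ hf₂ (hnn f₂) zero_le_one
    have h21' : (∫ x, |g₂ x|) * ∫ x, |f₁ x| ≤ 1 / M := by
      simpa using mul_le_mul hg₂ hf₁ (hnn f₁) (by positivity)
    have h22' : (∫ x, |g₂ x|) * ∫ x, |f₂ x| ≤ 1 / M := by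
      simpa using mul_le_mul hg₂ (hf₂.trans hM1) (hnn f₂) (by positivity)
    have h3 : 3 * B / M = B * (1 / M) + B * (1 / M) + B * (1 / M) := by ring
    have := mul_le_mul_of_nonneg_left h12' hB
    have := mul_le_mul_of_nonneg_left h21' hB
    have := mul_le_mul_of_nonneg_left h22' hB
    linarith
  refine ContinuousLinearMap.opNorm_le_of_unit_norm (by positivity) fun f hf => ?_
  set w := kernelOp K hK.squareIntegrable f
  rcases eq_or_ne w 0 with h0 | h0
  · rw [h0, norm_zero]
    positivity
  · have hw : ‖w‖ ≠ 0 := norm_ne_zero_iff.2 h0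
    have h := key f (‖w‖⁻¹ • w) hf (by rw [norm_smul, norm_inv, norm_norm, inv_mul_cancel₀ hw])
    rw [inner_smul_right, real_inner_self_eq_norm_sq, pow_two, inv_mul_cancel_left₀ hw] at h
    exact h

/-- If uniformly bounded kernels tend to `0` as bilinear forms on bounded functions, then their
operators tend to `0` in norm. -/
lemma tendsto_norm_kernelOp {K : ℕ → I → I → ℝ} {B : ℝ} (hK : ∀ n, IsBoundedKernel (K n) B)
    {δ : ℕ → ℝ} (hδ0 : Tendsto δ atTop (𝓝 0))
    (hδ : ∀ n, ∀ f g : I → ℝ, Measurable f → Measurable g → (∀ x, |f x| ≤ 1) → (∀ x, |g x| ≤ 1) →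
      |∫ p : I × I, K n p.1 p.2 * f p.1 * g p.2| ≤ δ n) :
    Tendsto (fun n => ‖kernelOp (K n) (hK n).squareIntegrable‖) atTop (𝓝 0) := by
  have hpos : ∀ n, 0 ≤ δ n := fun n => (abs_nonneg _).trans
    (hδ n (fun _ => 0) (fun _ => 0) measurable_const measurable_const (by simp) (by simp))
  have hB := (hK 0).nonneg
  refine tendsto_order.2 ⟨fun t ht => Eventually.of_forall fun n => ht.trans_le (norm_nonneg _),
    fun t ht => ?_⟩
  -- Makes `3 * B / M ≤ t / 2`; the summand `1` ensures `M ≥ 1`.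
  set M := 6 * B / t + 1
  have hM : 1 ≤ M := le_add_of_nonneg_left (by positivity)
  have hlim : Tendsto (fun n => M ^ 2 * δ n) atTop (𝓝 0) := by simpa using hδ0.const_mul (M ^ 2)
  filter_upwards [hlim.eventually (gt_mem_nhds (half_pos ht))] with n hn
  refine ((hK n).norm_kernelOp_le (hpos n) (hδ n) hM).trans_lt ?_
  have h3 : 3 * B / M ≤ t / 2 := by
    rw [div_le_iff₀ (by linarith)]
    have : t / 2 * M = 3 * B + t / 2 := by
      simp only [M]
      field_simp
      ring
    linarith
  linarith

end CutNorm

/-! ### Pullback along measure preserving maps -/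

section Pullback

/-- The form of `C T C*` at `x` is that of `T` at `C* x`, and at `C x` it is that of `T` at `x`
because `C* C = 1`. Both `C` and `C*` are contractions, so the comparison works both ways without
surjectivity of `C`. -/
lemma upperEigenvalue_conj_isometry {H H' : Type*} [NormedAddCommGroup H] [InnerProductSpace ℝ H]
    [CompleteSpace H] [NormedAddCommGroup H'] [InnerProductSpace ℝ H'] [CompleteSpace H']
    (C : H →ₗᵢ[ℝ] H') (T : H →L[ℝ] H) (i : ℕ) :
    upperEigenvalue (C.toContinuousLinearMap ∘L T ∘L C.toContinuousLinearMap.adjoint) i =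
      upperEigenvalue T i := by
  refine le_antisymm
    (upperEigenvalue_le_of_forall C.toContinuousLinearMap.adjoint.toLinearMap (fun x => ?_)
      fun x => ?_)
    (upperEigenvalue_le_of_forall C.toLinearMap (fun x => (C.norm_map x).le) fun x => ?_)
  · refine (ContinuousLinearMap.le_opNorm _ x).trans ?_
    rw [LinearIsometryEquiv.norm_map]
    exact mul_le_of_le_one_left (norm_nonneg x) C.norm_toContinuousLinearMap_le
  · exact ContinuousLinearMap.adjoint_inner_right _ _ _
  · have h : C.toContinuousLinearMap.adjoint (C x) = x := by
      refine ext_inner_right ℝ fun y => ?_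
      rw [ContinuousLinearMap.adjoint_inner_left]
      exact C.inner_map_map x y
    change inner ℝ (C (T (C.toContinuousLinearMap.adjoint (C x)))) (C x) = _
    rw [h, C.inner_map_map]

/-- With `C f = f ∘ φ`, the value at `x` is `⟨C (K (φ x)), f⟩ = ⟨K (φ x), C* f⟩`, which is `A_K (C*
f)` at `φ x`. The adjoint takes the place of composition with an inverse of `φ`. -/
lemma kernelOp_comp {K : I → I → ℝ} {B : ℝ} (hK : IsBoundedKernel K B) {φ : I → I}
    (hφ : MeasurePreserving φ volume volume)
    (hKφ : SquareIntegrable fun x y => K (φ x) (φ y)) :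
    kernelOp (fun x y => K (φ x) (φ y)) hKφ =
      (Lp.compMeasurePreservingₗᵢ ℝ φ hφ).toContinuousLinearMap ∘L
        kernelOp K hK.squareIntegrable ∘L
        (Lp.compMeasurePreservingₗᵢ ℝ φ hφ : L2 →ₗᵢ[ℝ] L2).toContinuousLinearMap.adjoint := by
  set C : L2 →ₗᵢ[ℝ] L2 := Lp.compMeasurePreservingₗᵢ ℝ φ hφ
  have hsec : ∀ x, MemLp (K x) 2 (volume : Measure I) := fun x =>
    MemLp.of_bound (hK.measurable.comp measurable_prodMk_left).aestronglyMeasurable B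
      (Eventually.of_forall fun y => hK.abs_le x y)
  ext1 f
  refine Lp.ext ?_
  set g := C.toContinuousLinearMap.adjoint f
  have h1 : C (kernelOp K hK.squareIntegrable g) =ᵐ[volume]
      kernelOp K hK.squareIntegrable g ∘ φ := Lp.coeFn_compMeasurePreserving _ hφ
  have h2 := hφ.quasiMeasurePreserving.ae (kernelOp_ae_eq K hK.squareIntegrable g)
  change _ =ᵐ[volume] C (kernelOp K hK.squareIntegrable g)
  filter_upwards [kernelOp_ae_eq _ hKφ f, h1, h2] with x hx1 hx2 hx3
  rw [hx1, hx2, Function.comp_apply, hx3]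
  have h4 : inner ℝ ((hsec (φ x)).toLp (K (φ x))) g = ∫ y, K (φ x) y * g y := by
    rw [L2.inner_def]
    refine integral_congr_ae ?_
    filter_upwards [(hsec (φ x)).coeFn_toLp] with y hy
    rw [hy]
    simp [mul_comm]
  have h5 : inner ℝ (C ((hsec (φ x)).toLp (K (φ x)))) f = ∫ y, K (φ x) (φ y) * f y := by
    rw [L2.inner_def]
    refine integral_congr_ae ?_
    filter_upwards [Lp.coeFn_compMeasurePreserving ((hsec (φ x)).toLp (K (φ x))) hφ,
      hφ.quasiMeasurePreserving.ae (hsec (φ x)).coeFn_toLp] with y hy hy'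
    have hy2 : (C ((hsec (φ x)).toLp (K (φ x)))) y = K (φ x) (φ y) := by
      rw [← hy']
      exact hy
    rw [hy2]
    simp [mul_comm]
  rw [← h4, ← h5]
  exact (ContinuousLinearMap.adjoint_inner_right C.toContinuousLinearMap _ f).symm

/-- The eigenvalues converge if the kernels converge in operator norm up to pullbacks. -/
lemma tendsto_upperEigenvalue_kernelOp {K : ℕ → I → I → ℝ} {K' : I → I → ℝ} {B : ℝ}
    (hK : ∀ n, IsBoundedKernel (K n) B) (hK' : IsBoundedKernel K' B) (φ : ℕ → MPMap)
    (h : Tendsto (fun n => ‖kernelOp (fun x y => K n x y - K' ((φ n).1 x) ((φ n).1 y))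
      ((hK n).sub (hK'.comp (φ n).2.measurable)).squareIntegrable‖) atTop (𝓝 0)) (i : ℕ) :
    Tendsto (fun n => upperEigenvalue (kernelOp (K n) (hK n).squareIntegrable) i) atTop
        (𝓝 (upperEigenvalue (kernelOp K' hK'.squareIntegrable) i)) ∧
      Tendsto (fun n => upperEigenvalue (-kernelOp (K n) (hK n).squareIntegrable) i) atTop
        (𝓝 (upperEigenvalue (-kernelOp K' hK'.squareIntegrable) i)) := by
  have hpull := fun n => kernelOp_comp hK' (φ n).2 (hK'.comp (φ n).2.measurable).squareIntegrable
  have hsub := fun n => kernelOp_sub (hK n).squareIntegrable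
    (hK'.comp (φ n).2.measurable).squareIntegrable
    ((hK n).sub (hK'.comp (φ n).2.measurable)).squareIntegrable
  constructor <;> refine tendsto_iff_dist_tendsto_zero.2
    (squeeze_zero (fun _ => dist_nonneg) (fun n => ?_) h)
  · rw [Real.dist_eq, ← upperEigenvalue_conj_isometry (Lp.compMeasurePreservingₗᵢ ℝ _ (φ n).2)
        (kernelOp K' hK'.squareIntegrable), ← hpull n, hsub n]
    exact abs_upperEigenvalue_sub_le _ _ i
  · rw [Real.dist_eq, ← upperEigenvalue_conj_isometry (Lp.compMeasurePreservingₗᵢ ℝ _ (φ n).2)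
        (-kernelOp K' hK'.squareIntegrable), ContinuousLinearMap.neg_comp,
      ContinuousLinearMap.comp_neg, ← hpull n, hsub n, ← norm_neg, neg_sub']
    exact abs_upperEigenvalue_sub_le _ _ i

end Pullback

/-! ### Codegree-sections and the cut metrics -/

section Sections

lemma measurePreserving_endpoints {k : ℕ} :
    MeasurePreserving (fun q : (I × I) × (Fin k → I) => endpoints q.1.1 q.1.2 q.2) := by
  refine ⟨measurable_endpoints, ?_⟩
  refine (Measure.pi_eq fun s hs => ?_).symm
  rw [Measure.map_apply measurable_endpoints (MeasurableSet.univ_pi hs)]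
  have hpre : (fun q : (I × I) × (Fin k → I) => endpoints q.1.1 q.1.2 q.2) ⁻¹' Set.univ.pi s =
      (s 0 ×ˢ s (Fin.last (k + 1))) ×ˢ Set.univ.pi fun l : Fin k => s l.castSucc.succ := by
    ext q
    simp only [Set.mem_preimage, Set.mem_univ_pi, Set.mem_prod, Fin.forall_fin_succ (n := k + 1),
      Fin.forall_fin_succ' (n := k), endpoints, Fin.cons_zero, Fin.cons_succ, Fin.snoc_castSucc,
      Fin.snoc_last, Fin.succ_last]
    tauto
  rw [hpre, Measure.volume_eq_prod, Measure.prod_prod, Measure.volume_eq_prod, Measure.prod_prod,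
    volume_pi, Measure.pi_pi, Fin.prod_univ_succ, Fin.prod_univ_castSucc, Fin.succ_last]
  ring

lemma abs_prod_testFun_le {r : ℕ} (f : Fin r → TestFun) (x : Fin r → I) :
    |∏ i, ((f i).1 (x i) : ℝ)| ≤ 1 := by
  rw [abs_of_nonneg (Finset.prod_nonneg fun i _ => ((f i).1 (x i)).2.1)]
  exact Finset.prod_le_one (fun i _ => ((f i).1 (x i)).2.1) fun i _ => ((f i).1 (x i)).2.2

lemma measurable_prod_testFun {r : ℕ} (f : Fin r → TestFun) :
    Measurable fun x : Fin r → I => ∏ i, ((f i).1 (x i) : ℝ) :=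
  Finset.measurable_prod _ fun i _ =>
    measurable_subtype_coe.comp ((f i).2.comp (measurable_pi_apply i))

lemma le_oneCutNorm {r : ℕ} {U : (Fin r → I) → ℝ} {B : ℝ} (hB : ∀ x, |U x| ≤ B)
    (f : Fin r → TestFun) :
    |∫ x : Fin r → I, U x * ∏ i, ((f i).1 (x i) : ℝ)| ≤ oneCutNorm U := by
  refine le_ciSup (f := fun f : Fin r → TestFun =>
    |∫ x : Fin r → I, U x * ∏ i, ((f i).1 (x i) : ℝ)|) ⟨B, ?_⟩ f
  rintro _ ⟨f, rfl⟩
  have h := norm_integral_le_of_norm_le_const (μ := (volume : Measure (Fin r → I)))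
    (f := fun x => U x * ∏ i, ((f i).1 (x i) : ℝ)) (C := B) (Eventually.of_forall fun x => by
      rw [Real.norm_eq_abs, abs_mul]
      exact (mul_le_of_le_one_right (abs_nonneg _) (abs_prod_testFun_le f x)).trans (hB x))
  simpa using h

lemma oneCutNorm_nonneg {r : ℕ} (U : (Fin r → I) → ℝ) : 0 ≤ oneCutNorm U :=
  Real.iSup_nonneg fun _ => abs_nonneg _

lemma cutNorm_nonneg (U : I → I → ℝ) : 0 ≤ cutNorm U := Real.iSup_nonneg fun _ => abs_nonneg _

lemma RGraphon.integrable_comp {k : ℕ} {β : Type*} [MeasureSpace β]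
    [IsFiniteMeasure (volume : Measure β)] (W : RGraphon k) {g : β → Fin k → I}
    (hg : Measurable g) : Integrable fun z => W (g z) :=
  Integrable.of_bound (W.measurable'.comp hg).aestronglyMeasurable 1
    (Eventually.of_forall fun z => by
      rw [Real.norm_eq_abs, abs_of_nonneg (W.mem_Icc' _).1]
      exact (W.mem_Icc' _).2)

lemma measurable_endpoints_right {k : ℕ} (x y : I) :
    Measurable fun z : Fin k → I => endpoints x y z :=
  measurable_endpoints.comp (g := fun q : (I × I) × (Fin k → I) => endpoints q.1.1 q.1.2 q.2)
    ((measurable_const (a := (x, y))).prodMk measurable_id)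

lemma endpoints_comp {k : ℕ} (φ : I → I) (x y : I) (z : Fin k → I) :
    (fun i => φ (endpoints x y z i)) = endpoints (φ x) (φ y) (fun i => φ (z i)) := by
  funext i
  refine Fin.cases ?_ (fun j => ?_) i
  · simp [endpoints]
  · refine Fin.lastCases ?_ (fun l => ?_) j <;> simp [endpoints]

/-- Taking sections commutes with pullback because `φ` applied coordinatewise preserves the measure
of the integrated variables. -/
lemma codegreeSection_comp {k : ℕ} (W : RGraphon (k + 2)) {φ : I → I}
    (hφ : MeasurePreserving φ volume volume) (x y : I) :
    codegreeSection W (φ x) (φ y) =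
      (1 / (k.factorial : ℝ)) * ∫ z : Fin k → I, W (fun i => φ (endpoints x y z i)) := by
  have hpi : MeasurePreserving (fun (z : Fin k → I) i => φ (z i)) volume volume :=
    volume_preserving_pi fun _ => hφ
  change (1 / (k.factorial : ℝ)) * ∫ z : Fin k → I, W (endpoints (φ x) (φ y) z) = _
  congr 1
  simp only [endpoints_comp]
  conv_lhs => rw [← hpi.map_eq]
  exact integral_map hpi.aemeasurable
    (W.measurable'.comp (measurable_endpoints_right _ _)).aestronglyMeasurable

/-- A pair `(f, g)` extends to `r` test functions by `f` and `g` at the ends and `1` in the middle;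
Fubini turns the form of the sections into `1/k!` times that of the hypergraphons. -/
lemma cutNorm_codegreeSection_sub_le {k : ℕ} (U W : RGraphon (k + 2)) (φ : MPMap) :
    cutNorm (fun x y => codegreeSection U x y - codegreeSection W (φ.1 x) (φ.1 y)) ≤
      oneCutNorm (fun x => U x - W (fun i => φ.1 (x i))) := by
  set D : (Fin (k + 2) → I) → ℝ := fun x => U x - W (fun i => φ.1 (x i))
  have hφm : Measurable fun (x : Fin (k + 2) → I) i => φ.1 (x i) :=
    measurable_pi_lambda _ fun i => φ.2.measurable.comp (measurable_pi_apply i)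
  have hDm : Measurable D := U.measurable'.sub (W.measurable'.comp hφm)
  have hD1 : ∀ x, |D x| ≤ 1 := fun x => by
    have h1 := U.mem_Icc' x
    have h2 := W.mem_Icc' (fun i => φ.1 (x i))
    exact abs_le.2 ⟨by linarith [h1.1, h2.2], by linarith [h1.2, h2.1]⟩
  have hsec : ∀ x y, codegreeSection U x y - codegreeSection W (φ.1 x) (φ.1 y) =
      (1 / (k.factorial : ℝ)) * ∫ z : Fin k → I, D (endpoints x y z) := by
    intro x y
    have h := integral_sub (U.integrable_comp (measurable_endpoints_right x y))
      (W.integrable_comp (hφm.comp (measurable_endpoints_right x y)))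
    rw [codegreeSection_comp W φ.2]
    refine Eq.trans ?_ (congrArg _ h.symm)
    rw [mul_sub]
    rfl
  refine Real.iSup_le (fun ⟨f, g⟩ => ?_) (oneCutNorm_nonneg _)
  let one : TestFun := ⟨fun _ => 1, measurable_const⟩
  let F : Fin (k + 2) → TestFun := Fin.cons f (Fin.snoc (fun _ => one) g)
  have hF : ∀ x y z, ∏ i, ((F i).1 (endpoints x y z i) : ℝ) = (f.1 x : ℝ) * (g.1 y : ℝ) := by
    intro x y z
    rw [Fin.prod_univ_succ, Fin.prod_univ_castSucc]
    simp [F, endpoints, one, -Fin.succ_last]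
  have hG : Measurable fun x => D x * ∏ i, ((F i).1 (x i) : ℝ) :=
    hDm.mul (measurable_prod_testFun F)
  have hGi : Integrable (fun q : (I × I) × (Fin k → I) => D (endpoints q.1.1 q.1.2 q.2) *
      ∏ i, ((F i).1 (endpoints q.1.1 q.1.2 q.2 i) : ℝ)) (volume.prod volume) :=
    Integrable.of_bound (hG.comp measurable_endpoints).aestronglyMeasurable 1
      (Eventually.of_forall fun q => by
        rw [Real.norm_eq_abs, abs_mul]
        exact mul_le_one₀ (hD1 _) (abs_nonneg _) (abs_prod_testFun_le F _))
  have heq : ∫ p : I × I, (codegreeSection U p.1 p.2 - codegreeSection W (φ.1 p.1) (φ.1 p.2)) *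
      (f.1 p.1 : ℝ) * (g.1 p.2 : ℝ) =
      (1 / (k.factorial : ℝ)) * ∫ x : Fin (k + 2) → I, D x * ∏ i, ((F i).1 (x i) : ℝ) := by
    conv_rhs => rw [← measurePreserving_endpoints.map_eq]
    rw [integral_map measurable_endpoints.aemeasurable hG.aestronglyMeasurable,
      Measure.volume_eq_prod (I × I), integral_prod _ hGi, ← integral_const_mul]
    refine integral_congr_ae (Eventually.of_forall fun p => ?_)
    simp only [hF, hsec]
    rw [integral_mul_const]
    ring
  have hk : (1 / (k.factorial : ℝ)) ≤ 1 := by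
    rw [div_le_one (by positivity)]
    exact_mod_cast Nat.one_le_iff_ne_zero.mpr k.factorial_ne_zero
  simp only
  rw [heq, abs_mul, abs_of_nonneg (by positivity)]
  exact (mul_le_of_le_one_left (abs_nonneg _) hk).trans (le_oneCutNorm hD1 F)

lemma cutDist_nonneg (U W : Graphon) : 0 ≤ cutDist U W :=
  Real.iInf_nonneg fun _ => cutNorm_nonneg _

lemma cutDist_codegreeSection_le {k : ℕ} (U W : RGraphon (k + 2)) :
    cutDist (codegreeSection U) (codegreeSection W) ≤ oneCutDist U W :=
  ciInf_mono ⟨0, by rintro _ ⟨φ, rfl⟩; exact cutNorm_nonneg _⟩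
    fun φ => cutNorm_codegreeSection_sub_le U W φ

end Sections

/-! ### Convergence of spectra of graphons -/

section GraphonSpectra

lemma Graphon.isBoundedKernel (W : Graphon) : IsBoundedKernel W.toFun 1 :=
  ⟨W.measurable', fun x y => by
    rw [abs_of_nonneg (W.mem_Icc' x y).1]
    exact (W.mem_Icc' x y).2⟩

instance : Nonempty MPMap := ⟨⟨id, MeasurePreserving.id _⟩⟩

/-- The infimum over `φ` need not be attained, so a map within `1 / (n + 1)` of it is used. -/
lemma exists_tendsto_cutNorm {U : ℕ → Graphon} {V : Graphon}
    (h : Tendsto (fun n => cutDist (U n) V) atTop (𝓝 0)) :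
    ∃ φ : ℕ → MPMap, Tendsto
      (fun n => cutNorm (fun x y => U n x y - V ((φ n).1 x) ((φ n).1 y))) atTop (𝓝 0) := by
  have hex : ∀ n : ℕ, ∃ φ : MPMap, cutNorm (fun x y => U n x y - V (φ.1 x) (φ.1 y)) <
      cutDist (U n) V + 1 / ((n : ℝ) + 1) := fun n =>
    exists_lt_of_ciInf_lt (lt_add_of_pos_right _ (by positivity))
  choose φ hφ using hex
  refine ⟨φ, squeeze_zero (fun _ => cutNorm_nonneg _) (fun n => (hφ n).le) ?_⟩
  simpa using h.add tendsto_one_div_add_atTop_nhds_zero_nat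

lemma spectraConverge_op {U : ℕ → Graphon} {V : Graphon}
    (h : Tendsto (fun n => cutDist (U n) V) atTop (𝓝 0)) :
    SpectraConverge (fun n => (U n).op) V.op 0 := by
  obtain ⟨φ, hφ⟩ := exists_tendsto_cutNorm h
  have hD := fun n => (U n).isBoundedKernel.sub (V.isBoundedKernel.comp (φ n).2.measurable)
  have hnorm := tendsto_norm_kernelOp hD (δ := fun n => 4 * cutNorm (fun x y => U n x y -
    V ((φ n).1 x) ((φ n).1 y))) (by simpa using hφ.const_mul 4)
    fun n f g hf hg hf1 hg1 => abs_form_le_cutNorm (hD n) hf hg hf1 hg1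
  have hlim := tendsto_upperEigenvalue_kernelOp (fun n => (U n).isBoundedKernel)
    V.isBoundedKernel φ hnorm
  exact ⟨_, _, _, _,
    fun n => isSpectralEnumeration_upperEigenvalue (isCompactOperator_kernelOp _)
      (isSymmetric_kernelOp _ (U n).symm'),
    isSpectralEnumeration_upperEigenvalue (isCompactOperator_kernelOp _)
      (isSymmetric_kernelOp _ V.symm'),
    fun i => (hlim i).1, fun i => (hlim i).2.neg⟩

end GraphonSpectra

/-! ### The random walk Laplacian -/

section Laplacian

lemma memLp_mul {h : I → ℝ} (hm : Measurable h) {c : ℝ} (hc : ∀ x, |h x| ≤ c) (f : L2) :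
    MemLp (fun x => h x * f x) 2 (volume : Measure I) := by
  refine (Lp.memLp f).of_le_mul (c := c)
    (hm.aestronglyMeasurable.mul (Lp.aestronglyMeasurable f)) (Eventually.of_forall fun x => ?_)
  rw [norm_mul]
  exact mul_le_mul_of_nonneg_right (hc x) (norm_nonneg _)

/-- Multiplication by a bounded measurable function on `L²`. -/
noncomputable def mulOp (h : I → ℝ) (hm : Measurable h) (c : ℝ) (hc : ∀ x, |h x| ≤ c) :
    L2 →L[ℝ] L2 :=
  LinearMap.mkContinuous
    { toFun := fun f => (memLp_mul hm hc f).toLp _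
      map_add' := fun f g => by
        rw [← MemLp.toLp_add]
        refine MemLp.toLp_congr _ _ ?_
        filter_upwards [Lp.coeFn_add f g] with x hx
        rw [hx, Pi.add_apply, Pi.add_apply, mul_add]
      map_smul' := fun a f => by
        rw [RingHom.id_apply, ← MemLp.toLp_const_smul]
        refine MemLp.toLp_congr _ _ ?_
        filter_upwards [Lp.coeFn_smul a f] with x hx
        rw [hx, Pi.smul_apply, Pi.smul_apply, smul_eq_mul, smul_eq_mul]
        ring }
    c (fun f => by
      refine Lp.norm_le_mul_norm_of_ae_le_mul ?_
      filter_upwards [(memLp_mul hm hc f).coeFn_toLp] with x hx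
      rw [LinearMap.coe_mk, AddHom.coe_mk, hx, norm_mul]
      exact mul_le_mul_of_nonneg_right (hc x) (norm_nonneg _))

lemma mulOp_ae_eq (h : I → ℝ) (hm : Measurable h) (c : ℝ) (hc : ∀ x, |h x| ≤ c) (f : L2) :
    mulOp h hm c hc f =ᵐ[volume] fun x => h x * f x :=
  (memLp_mul hm hc f).coeFn_toLp

/-- Multiplication by a bounded function with bounded inverse, as an automorphism of `L²`. -/
noncomputable def mulEquiv (h : I → ℝ) (hm : Measurable h) (c c' : ℝ) (hc : ∀ x, |h x| ≤ c)
    (hc' : ∀ x, |(h x)⁻¹| ≤ c') (h0 : ∀ x, h x ≠ 0) : L2 ≃L[ℝ] L2 :=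
  ContinuousLinearEquiv.equivOfInverse (mulOp h hm c hc)
    (mulOp (fun x => (h x)⁻¹) hm.inv c' hc')
    (fun f => Lp.ext (by
      filter_upwards [mulOp_ae_eq (fun x => (h x)⁻¹) hm.inv c' hc' (mulOp h hm c hc f),
        mulOp_ae_eq h hm c hc f] with x h1 h2
      rw [h1, h2, inv_mul_cancel_left₀ (h0 x)]))
    (fun f => Lp.ext (by
      filter_upwards [mulOp_ae_eq h hm c hc (mulOp (fun x => (h x)⁻¹) hm.inv c' hc' f),
        mulOp_ae_eq (fun x => (h x)⁻¹) hm.inv c' hc' f] with x h1 h2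
      rw [h1, h2, mul_inv_cancel_left₀ (h0 x)]))

/-- Conjugating the operator of `h(x) K(x,y) h(y)` by multiplication by `h` gives the operator of
`h(x)² K(x,y)`. -/
lemma kernelOp_mulEquiv_conj {K : I → I → ℝ} {h : I → ℝ} {hm : Measurable h} {c c' : ℝ}
    {hc : ∀ x, |h x| ≤ c} {hc' : ∀ x, |(h x)⁻¹| ≤ c'} {h0 : ∀ x, h x ≠ 0}
    (hS : SquareIntegrable fun x y => h x * K x y * h y)
    (hR : SquareIntegrable fun x y => h x ^ 2 * K x y) :
    kernelOp _ hR = (mulEquiv h hm c c' hc hc' h0 : L2 →L[ℝ] L2) ∘L kernelOp _ hS ∘L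
      ((mulEquiv h hm c c' hc hc' h0).symm : L2 →L[ℝ] L2) := by
  ext1 f
  set g := mulOp (fun x => (h x)⁻¹) hm.inv c' hc' f
  change _ = mulOp h hm c hc (kernelOp _ hS g)
  refine Lp.ext ?_
  filter_upwards [kernelOp_ae_eq _ hR f, mulOp_ae_eq h hm c hc (kernelOp _ hS g),
    kernelOp_ae_eq _ hS g] with x h1 h2 h3
  rw [h1, h2, h3, ← integral_const_mul]
  refine integral_congr_ae ?_
  filter_upwards [mulOp_ae_eq (fun x => (h x)⁻¹) hm.inv c' hc' f] with y hy
  rw [hy]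
  have := h0 y
  field_simp

/-- The inverse square root of `a`, truncated below at `ε`. -/
noncomputable def invSqrtMax (ε a : ℝ) : ℝ := (√(max a ε))⁻¹

/-! ### Bounds and Lipschitz continuity of the truncated inverse square root -/

section invSqrtMax

variable {ε : ℝ} (hε : 0 < ε)

include hε

lemma invSqrtMax_pos (a : ℝ) : 0 < invSqrtMax ε a :=
  inv_pos.2 (Real.sqrt_pos.2 (hε.trans_le (le_max_right _ _)))

lemma invSqrtMax_le (a : ℝ) : invSqrtMax ε a ≤ (√ε)⁻¹ :=
  inv_anti₀ (Real.sqrt_pos.2 hε) (Real.sqrt_le_sqrt (le_max_right _ _))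

lemma abs_invSqrtMax_le (a : ℝ) : |invSqrtMax ε a| ≤ (√ε)⁻¹ := by
  rw [abs_of_pos (invSqrtMax_pos hε a)]
  exact invSqrtMax_le hε a

lemma invSqrtMax_sq {a : ℝ} (ha : ε ≤ a) : invSqrtMax ε a ^ 2 = a⁻¹ := by
  rw [invSqrtMax, max_eq_left ha, inv_pow, Real.sq_sqrt (hε.le.trans ha)]

/-- `1/√u - 1/√v = (v - u) / (√u √v (√u + √v))`, where each of the three factors below is at least
`√ε`; truncation itself is 1-Lipschitz. -/
lemma abs_invSqrtMax_sub_le (a b : ℝ) :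
    |invSqrtMax ε a - invSqrtMax ε b| ≤ (√ε)⁻¹ ^ 3 * |a - b| := by
  have key : ∀ u v : ℝ, ε ≤ u → ε ≤ v → |(√u)⁻¹ - (√v)⁻¹| ≤ (√ε)⁻¹ ^ 3 * |u - v| := by
    intro u v hu hv
    have hs : 0 < √ε := Real.sqrt_pos.2 hε
    have hsu : √ε ≤ √u := Real.sqrt_le_sqrt hu
    have hsv : √ε ≤ √v := Real.sqrt_le_sqrt hv
    have hu0 : 0 < √u := hs.trans_le hsu
    have hv0 : 0 < √v := hs.trans_le hsv
    have h1 : (√u)⁻¹ - (√v)⁻¹ = (√u)⁻¹ * (√v)⁻¹ * (√u + √v)⁻¹ * (v - u) := by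
      have h2 : v - u = (√v - √u) * (√u + √v) := by
        nlinarith [Real.sq_sqrt (hε.le.trans hu), Real.sq_sqrt (hε.le.trans hv)]
      rw [h2]
      field_simp
    rw [h1, abs_mul, abs_sub_comm v u, abs_of_pos (by positivity)]
    refine mul_le_mul_of_nonneg_right ?_ (abs_nonneg _)
    have h3 := inv_anti₀ hs hsu
    have h4 := inv_anti₀ hs hsv
    have h5 : (√u + √v)⁻¹ ≤ (√ε)⁻¹ := inv_anti₀ hs (by linarith)
    rw [pow_succ, pow_two]
    gcongr
  refine (key _ _ (le_max_right a ε) (le_max_right b ε)).trans ?_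
  exact mul_le_mul_of_nonneg_left (abs_max_sub_max_le_abs a b ε) (by positivity)

end invSqrtMax

lemma measurable_invSqrtMax (ε : ℝ) : Measurable (invSqrtMax ε) := by
  unfold invSqrtMax
  fun_prop

/-! ### Degrees and the symmetrized random walk kernel -/

namespace Graphon

lemma measurable_degree (W : Graphon) : Measurable W.degree :=
  W.measurable'.stronglyMeasurable.integral_prod_right'.measurable

lemma integrable_section (W : Graphon) (x : I) : Integrable (W x) :=
  integrable_of_abs_le (W.measurable'.comp measurable_prodMk_left) (W.isBoundedKernel.abs_le x)

lemma degree_le_one (W : Graphon) (x : I) : W.degree x ≤ 1 := by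
  have := integral_mono (W.integrable_section x) (integrable_const (1 : ℝ))
    fun y => (W.mem_Icc' x y).2
  simpa [degree] using this

lemma degree_comp (W : Graphon) (φ : MPMap) (x : I) :
    ∫ y, W (φ.1 x) (φ.1 y) = W.degree (φ.1 x) := by
  have h := integral_map (f := W (φ.1 x)) φ.2.aemeasurable
    (W.measurable'.comp measurable_prodMk_left).aestronglyMeasurable
  rw [φ.2.map_eq] at h
  exact h.symm

/-- The factor `1 / √(max d_W ε)`. -/
noncomputable def weight (W : Graphon) (ε : ℝ) (x : I) : ℝ := invSqrtMax ε (W.degree x)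

lemma measurable_weight (W : Graphon) (ε : ℝ) : Measurable (W.weight ε) :=
  (measurable_invSqrtMax ε).comp W.measurable_degree

/-- The symmetric kernel similar to the random walk kernel. -/
noncomputable def symmKernel (W : Graphon) (ε : ℝ) (x y : I) : ℝ :=
  W.weight ε x * W x y * W.weight ε y

lemma symmKernel_symm (W : Graphon) (ε : ℝ) (x y : I) :
    W.symmKernel ε x y = W.symmKernel ε y x := by
  rw [symmKernel, symmKernel, W.symm' x y]
  ring

lemma isBoundedKernel_symmKernel (W : Graphon) {ε : ℝ} (hε : 0 < ε) :
    IsBoundedKernel (W.symmKernel ε) ((√ε)⁻¹ * 1 * (√ε)⁻¹) := by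
  refine ⟨(((W.measurable_weight ε).comp measurable_fst).mul W.measurable').mul
    ((W.measurable_weight ε).comp measurable_snd), fun x y => ?_⟩
  rw [symmKernel, abs_mul, abs_mul]
  have h1 := abs_invSqrtMax_le hε (W.degree x)
  have h2 := abs_invSqrtMax_le hε (W.degree y)
  have h3 := W.isBoundedKernel.abs_le x y
  unfold weight
  gcongr

lemma isBoundedKernel_sq_weight (W : Graphon) {ε : ℝ} (hε : 0 < ε) :
    IsBoundedKernel (fun x y => W.weight ε x ^ 2 * W x y) ((√ε)⁻¹ ^ 2 * 1) := by
  refine ⟨(((W.measurable_weight ε).comp measurable_fst).pow_const 2).mul W.measurable',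
    fun x y => ?_⟩
  rw [abs_mul, abs_pow]
  have h1 := abs_invSqrtMax_le hε (W.degree x)
  have h3 := W.isBoundedKernel.abs_le x y
  unfold weight
  gcongr

lemma rwKernel_ae_eq (W : Graphon) {ε : ℝ} (hε : 0 < ε) (hd : ∀ᵐ x : I, ε ≤ W.degree x) :
    Function.uncurry (fun x y => W.weight ε x ^ 2 * W x y) =ᵐ[volume]
      Function.uncurry W.rwKernel := by
  have hfst : MeasurePreserving (Prod.fst : I × I → I) volume volume := measurePreserving_fst
  filter_upwards [hfst.quasiMeasurePreserving.ae hd] with p hp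
  simp only [Function.uncurry, weight, rwKernel]
  rw [if_pos (hε.trans_le hp), invSqrtMax_sq hε hp, div_eq_inv_mul]

lemma squareIntegrable_rwKernel (W : Graphon) {ε : ℝ} (hε : 0 < ε)
    (hd : ∀ᵐ x : I, ε ≤ W.degree x) : SquareIntegrable W.rwKernel :=
  (memLp_congr_ae (W.rwKernel_ae_eq hε hd)).1 (W.isBoundedKernel_sq_weight hε).squareIntegrable

/-- With `h` the weight, the random walk kernel is almost everywhere `h(x)² W(x,y)`, conjugate by
multiplication by `h` to the symmetric `h(x) W(x,y) h(y)`. Truncation at `ε` keeps `h` and its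
inverse bounded everywhere, even on the null set of small degrees. -/
lemma isSpectralEnumeration_laplacian (W : Graphon) {ε : ℝ} (hε : 0 < ε)
    (hd : ∀ᵐ x : I, ε ≤ W.degree x) (hW : SquareIntegrable W.rwKernel) :
    IsSpectralEnumeration (W.laplacian hW) 1
      (fun i => 1 - -upperEigenvalue
        (-kernelOp (W.symmKernel ε) (W.isBoundedKernel_symmKernel hε).squareIntegrable) i)
      (fun i => 1 - upperEigenvalue
        (kernelOp (W.symmKernel ε) (W.isBoundedKernel_symmKernel hε).squareIntegrable) i) := by
  have hinv : ∀ x, |(W.weight ε x)⁻¹| ≤ √(max 1 ε) := fun x => by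
    rw [weight, invSqrtMax, inv_inv, abs_of_nonneg (Real.sqrt_nonneg _)]
    exact Real.sqrt_le_sqrt (max_le_max_right _ (W.degree_le_one x))
  refine (isSpectralEnumeration_upperEigenvalue (isCompactOperator_kernelOp _)
    (isSymmetric_kernelOp _ (W.symmKernel_symm ε))).one_sub_conj
    (mulEquiv (W.weight ε) (W.measurable_weight ε) (√ε)⁻¹ (√(max 1 ε))
      (fun x => abs_invSqrtMax_le hε _) hinv fun x => (invSqrtMax_pos hε _).ne') ?_
  rw [laplacian, ← kernelOp_congr (W.isBoundedKernel_sq_weight hε).squareIntegrable hW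
    (W.rwKernel_ae_eq hε hd)]
  congr 1
  exact kernelOp_mulEquiv_conj (W.isBoundedKernel_symmKernel hε).squareIntegrable _

/-- The degrees are `L¹`-close if the graphons are close in cut norm. -/
lemma integral_abs_degree_sub_le (U V : Graphon) (φ : MPMap) :
    ∫ x, |U.degree x - V.degree (φ.1 x)| ≤
      4 * cutNorm (fun x y => U x y - V (φ.1 x) (φ.1 y)) := by
  have hD := U.isBoundedKernel.sub (V.isBoundedKernel.comp φ.2.measurable)
  set e : I → ℝ := fun x => U.degree x - V.degree (φ.1 x)
  have hem : Measurable e := U.measurable_degree.sub (V.measurable_degree.comp φ.2.measurable)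
  -- Testing with the sign of the degree difference in one variable and `1` in the other produces
  -- its `L¹` norm.
  let s : I → ℝ := fun x => if 0 ≤ e x then 1 else -1
  have hsm : Measurable s :=
    Measurable.ite (measurableSet_le measurable_const hem) measurable_const measurable_const
  have hs1 : ∀ x, |s x| ≤ 1 := fun x => by
    simp only [s]
    split_ifs <;> simp
  have h := abs_form_le_cutNorm hD hsm (measurable_const (a := (1 : ℝ))) hs1 (by simp)
  refine le_trans (le_of_eq ?_) ((le_abs_self _).trans h)
  have hint := hD.integrable_form (integrable_of_abs_le hsm hs1) (integrable_const (1 : ℝ))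
  refine Eq.trans ?_ (integral_prod _ hint).symm
  refine integral_congr_ae (Eventually.of_forall fun x => ?_)
  have hsec : ∫ y, (U x y - V (φ.1 x) (φ.1 y)) = e x := by
    have hVφ := V.isBoundedKernel.comp φ.2.measurable
    have h := integral_sub (U.integrable_section x)
      (integrable_of_abs_le (hVφ.measurable.comp measurable_prodMk_left) (hVφ.abs_le x))
    refine h.trans ?_
    exact congrArg (U.degree x - ·) (V.degree_comp φ x)
  simp only [mul_one]
  rw [integral_mul_const, hsec]
  simp only [s]
  split_ifs with h0
  · rw [mul_one]
    exact abs_of_nonneg h0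
  · rw [mul_neg, mul_one]
    exact abs_of_neg (not_le.1 h0)

lemma integrable_degree (W : Graphon) : Integrable W.degree :=
  integrable_of_abs_le W.measurable_degree (c := 1) fun x => by
    rw [abs_of_nonneg (show 0 ≤ W.degree x from integral_nonneg fun y => (W.mem_Icc' x y).1)]
    exact W.degree_le_one x

lemma integrable_degree_comp (W : Graphon) (φ : MPMap) :
    Integrable fun x => W.degree (φ.1 x) :=
  (φ.2.integrable_comp W.measurable_degree.aestronglyMeasurable).2 W.integrable_degree

/-- A lower bound on the degrees passes to the limit. -/
lemma le_degree_of_tendsto {U : ℕ → Graphon} {V : Graphon} {φ : ℕ → MPMap}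
    (hφ : Tendsto (fun n => cutNorm (fun x y => U n x y - V ((φ n).1 x) ((φ n).1 y))) atTop (𝓝 0))
    {ε : ℝ} (hd : ∀ n, ∀ᵐ x : I, ε ≤ (U n).degree x) : ∀ᵐ x : I, ε ≤ V.degree x := by
  have hm : Measurable fun x => max (ε - V.degree x) 0 :=
    (V.measurable_degree.const_sub ε).max measurable_const
  have hi : Integrable fun x => max (ε - V.degree x) 0 :=
    ((integrable_const ε).sub V.integrable_degree).sup (integrable_zero _ _ _)
  -- The defect `max (ε - d_V) 0` has the same integral after pullback by `φ n`, where it is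
  -- dominated by the difference of degrees because `d_(U n) ≥ ε`.
  have hle : ∀ n, ∫ x, max (ε - V.degree x) 0 ≤
      4 * cutNorm (fun x y => U n x y - V ((φ n).1 x) ((φ n).1 y)) := by
    intro n
    refine le_trans ?_ ((U n).integral_abs_degree_sub_le V (φ n))
    have hmap : ∫ x, max (ε - V.degree x) 0 = ∫ x, max (ε - V.degree ((φ n).1 x)) 0 := by
      have h := integral_map (φ n).2.aemeasurable hm.aestronglyMeasurable
      rwa [(φ n).2.map_eq] at h
    rw [hmap]
    refine integral_mono_of_nonneg (Eventually.of_forall fun x => le_max_right _ _)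
      ((U n).integrable_degree.sub (V.integrable_degree_comp (φ n))).abs ?_
    filter_upwards [hd n] with x hx
    refine max_le ?_ (abs_nonneg _)
    exact le_trans (by linarith) (le_abs_self _)
  have h0 : ∫ x, max (ε - V.degree x) 0 = 0 := by
    refine le_antisymm ?_ (integral_nonneg fun x => le_max_right _ _)
    exact ge_of_tendsto' (by simpa using hφ.const_mul 4) hle
  filter_upwards [(integral_eq_zero_iff_of_nonneg
    (show 0 ≤ fun x => max (ε - V.degree x) 0 from fun x => le_max_right _ _) hi).1 h0] with x hx
  have h1 := le_max_left (ε - V.degree x) 0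
  have hx' : max (ε - V.degree x) 0 = 0 := hx
  linarith

/-- The forms of the symmetrized kernels are close if the graphons are close in cut norm. -/
lemma abs_form_symmKernel_sub_le (U V : Graphon) (φ : MPMap) {ε : ℝ} (hε : 0 < ε) {f g : I → ℝ}
    (hf : Measurable f) (hg : Measurable g) (hf1 : ∀ x, |f x| ≤ 1) (hg1 : ∀ x, |g x| ≤ 1) :
    |∫ p : I × I, (U.symmKernel ε p.1 p.2 - V.symmKernel ε (φ.1 p.1) (φ.1 p.2)) *
        f p.1 * g p.2| ≤
      (2 * (√ε)⁻¹ ^ 4 + (√ε)⁻¹ ^ 2) *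
        (4 * cutNorm (fun x y => U x y - V (φ.1 x) (φ.1 y))) := by
  have hD := U.isBoundedKernel.sub (V.isBoundedKernel.comp φ.2.measurable)
  have hdeg := U.integral_abs_degree_sub_le V φ
  set η := 4 * cutNorm (fun x y => U x y - V (φ.1 x) (φ.1 y))
  set c := (√ε)⁻¹
  have hc : 0 < c := inv_pos.2 (Real.sqrt_pos.2 hε)
  set h := U.weight ε
  set h' : I → ℝ := fun x => V.weight ε (φ.1 x)
  have hm : Measurable h := U.measurable_weight ε
  have hm' : Measurable h' := (V.measurable_weight ε).comp φ.2.measurable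
  have hc1 : ∀ x, |h x| ≤ c := fun x => abs_invSqrtMax_le hε _
  have hc1' : ∀ x, |h' x| ≤ c := fun x => abs_invSqrtMax_le hε _
  have hmul : ∀ {u v : I → ℝ} {a b : ℝ}, (∀ x, |u x| ≤ a) → (∀ x, |v x| ≤ b) →
      ∀ x, |u x * v x| ≤ a * b := fun hu hv x => by
    rw [abs_mul]
    exact mul_le_mul (hu x) (hv x) (abs_nonneg _) ((abs_nonneg _).trans (hu x))
  have hsubc : ∀ x, |h x - h' x| ≤ c + c := fun x =>
    (abs_sub _ _).trans (add_le_add (hc1 x) (hc1' x))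
  have hdiff : ∀ u : I → ℝ, (∀ x, |u x| ≤ 1) → Measurable u →
      ∫ x, |(h x - h' x) * u x| ≤ c ^ 3 * η := by
    intro u hu hum
    have hle : ∫ x, |(h x - h' x) * u x| ≤ ∫ x, c ^ 3 * |U.degree x - V.degree (φ.1 x)| := by
      refine integral_mono_of_nonneg (Eventually.of_forall fun x => abs_nonneg _)
        ((U.integrable_degree.sub (V.integrable_degree_comp φ)).abs.const_mul _)
        (Eventually.of_forall fun x => ?_)
      simp only [abs_mul]
      exact (mul_le_of_le_one_right (abs_nonneg _) (hu x)).trans (abs_invSqrtMax_sub_le hε _ _)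
    rw [integral_const_mul] at hle
    exact hle.trans (mul_le_mul_of_nonneg_left hdeg (by positivity))
  have hbd : ∀ u : I → ℝ, (∀ x, |u x| ≤ 1) → ∀ w : I → ℝ, (∀ x, |w x| ≤ c) →
      ∫ x, |w x * u x| ≤ c := fun u hu w hw =>
    integral_abs_le_of_abs_le fun x => (hmul hw hu x).trans_eq (mul_one c)
  have hi1 : ∀ u : I → ℝ, Measurable u → (∀ x, |u x| ≤ 1) →
      Integrable fun x => (h x - h' x) * u x := fun u hum hu =>
    integrable_of_abs_le ((hm.sub hm').mul hum) (hmul hsubc hu)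
  have hi2 : ∀ u : I → ℝ, Measurable u → (∀ x, |u x| ≤ 1) → ∀ w : I → ℝ, Measurable w →
      (∀ x, |w x| ≤ c) → Integrable fun x => w x * u x := fun u hum hu w hwm hw =>
    integrable_of_abs_le (hwm.mul hum) (hmul hw hu)
  have hI1 := U.isBoundedKernel.integrable_form (hi1 f hf hf1) (hi2 g hg hg1 h hm hc1)
  have hI2 := U.isBoundedKernel.integrable_form (hi2 f hf hf1 h' hm' hc1') (hi1 g hg hg1)
  have hI3 := hD.integrable_form (hi2 f hf hf1 h' hm' hc1') (hi2 g hg hg1 h' hm' hc1')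
  have hη : 0 ≤ η := mul_nonneg (by norm_num) (cutNorm_nonneg _)
  -- Telescoping `h U h - h' V^φ h' = (h - h') U h + h' U (h - h') + h' (U - V^φ) h'`. The first two
  -- terms use that the weights are `L¹`-close with constant `c ^ 3`; the third uses the cut norm
  -- with test functions rescaled by `c`.
  have hT1 : |∫ p : I × I, U p.1 p.2 * ((h p.1 - h' p.1) * f p.1) * (h p.2 * g p.2)| ≤
      c ^ 4 * η := by
    refine (U.isBoundedKernel.abs_form_le (hi1 f hf hf1) (hi2 g hg hg1 h hm hc1)).trans ?_
    rw [one_mul]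
    refine (mul_le_mul (hdiff f hf1 hf) (hbd g hg1 h hc1)
      (integral_nonneg fun _ => abs_nonneg _) (by positivity)).trans_eq ?_
    ring
  have hT2 : |∫ p : I × I, U p.1 p.2 * (h' p.1 * f p.1) * ((h p.2 - h' p.2) * g p.2)| ≤
      c ^ 4 * η := by
    refine (U.isBoundedKernel.abs_form_le (hi2 f hf hf1 h' hm' hc1') (hi1 g hg hg1)).trans ?_
    rw [one_mul]
    refine (mul_le_mul (hbd f hf1 h' hc1') (hdiff g hg1 hg)
      (integral_nonneg fun _ => abs_nonneg _) hc.le).trans_eq ?_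
    ring
  have hT3 : |∫ p : I × I, (U p.1 p.2 - V (φ.1 p.1) (φ.1 p.2)) * (h' p.1 * f p.1) *
      (h' p.2 * g p.2)| ≤ c ^ 2 * η := by
    have hnorm : ∀ u : I → ℝ, (∀ x, |u x| ≤ 1) → ∀ x, |h' x * u x / c| ≤ 1 := fun u hu x => by
      rw [abs_div, abs_of_pos hc]
      exact div_le_one_of_le₀ ((hmul hc1' hu x).trans_eq (mul_one c)) hc.le
    have hcut := abs_form_le_cutNorm hD ((hm'.mul hf).div_const c) ((hm'.mul hg).div_const c)
      (hnorm f hf1) (hnorm g hg1)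
    have heq : ∫ p : I × I, (U p.1 p.2 - V (φ.1 p.1) (φ.1 p.2)) * (h' p.1 * f p.1) *
        (h' p.2 * g p.2) = c ^ 2 * ∫ p : I × I, (U p.1 p.2 - V (φ.1 p.1) (φ.1 p.2)) *
          (h' p.1 * f p.1 / c) * (h' p.2 * g p.2 / c) := by
      rw [← integral_const_mul]
      refine integral_congr_ae (Eventually.of_forall fun p => ?_)
      simp only
      field_simp
    rw [heq, abs_mul, abs_of_nonneg (by positivity)]
    exact mul_le_mul_of_nonneg_left hcut (by positivity)
  have heq : ∫ p : I × I, (U.symmKernel ε p.1 p.2 - V.symmKernel ε (φ.1 p.1) (φ.1 p.2)) *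
      f p.1 * g p.2 =
      (∫ p : I × I, U p.1 p.2 * ((h p.1 - h' p.1) * f p.1) * (h p.2 * g p.2)) +
      (∫ p : I × I, U p.1 p.2 * (h' p.1 * f p.1) * ((h p.2 - h' p.2) * g p.2)) +
      ∫ p : I × I, (U p.1 p.2 - V (φ.1 p.1) (φ.1 p.2)) * (h' p.1 * f p.1) *
        (h' p.2 * g p.2) := by
    rw [← integral_add hI1 hI2]
    refine Eq.trans ?_ (integral_add (hI1.add hI2) hI3)
    refine integral_congr_ae (Eventually.of_forall fun p => ?_)
    simp only [symmKernel, h, h']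
    ring
  rw [heq]
  refine (abs_add_three _ _ _).trans ?_
  linarith

end Graphon

lemma spectraConverge_laplacian {U : ℕ → Graphon} {V : Graphon}
    (h : Tendsto (fun n => cutDist (U n) V) atTop (𝓝 0)) {ε : ℝ} (hε : 0 < ε)
    (hd : ∀ n, ∀ᵐ x : I, ε ≤ (U n).degree x) :
    ∃ (hn : ∀ n, SquareIntegrable (U n).rwKernel) (hV : SquareIntegrable V.rwKernel),
      SpectraConverge (fun n => (U n).laplacian (hn n)) (V.laplacian hV) 1 := by
  obtain ⟨φ, hφ⟩ := exists_tendsto_cutNorm h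
  have hdV := Graphon.le_degree_of_tendsto hφ hd
  have hK := fun n => (U n).isBoundedKernel_symmKernel hε
  have hK' := V.isBoundedKernel_symmKernel hε
  have hδ := (hφ.const_mul 4).const_mul (2 * (√ε)⁻¹ ^ 4 + (√ε)⁻¹ ^ 2)
  rw [mul_zero, mul_zero] at hδ
  have hnorm := tendsto_norm_kernelOp
    (fun n => (hK n).sub (hK'.comp (φ n).2.measurable))
    hδ
    fun n f g hf hg hf1 hg1 => (U n).abs_form_symmKernel_sub_le V (φ n) hε hf hg hf1 hg1
  have hlim := tendsto_upperEigenvalue_kernelOp hK hK' φ hnorm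
  -- The reflection `μ ↦ 1 - μ` turns negative eigenvalues of the symmetrized operator into the list
  -- above `1`, and positive ones into the list below.
  exact ⟨fun n => (U n).squareIntegrable_rwKernel hε (hd n),
    V.squareIntegrable_rwKernel hε hdV, _, _, _, _,
    fun n => (U n).isSpectralEnumeration_laplacian hε (hd n) _,
    V.isSpectralEnumeration_laplacian hε hdV _,
    fun i => (hlim i).2.neg.const_sub 1, fun i => (hlim i).1.const_sub 1⟩

end Laplacian

end HypergraphLimit

/-! ### Convergence of codegree-sections and of their spectra -/

theorem mainTheorem1 (k : ℕ) (Wseq : ℕ → HypergraphLimit.RGraphon (k + 2))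
    (W : HypergraphLimit.RGraphon (k + 2))
    (hconv : Tendsto (fun n => HypergraphLimit.oneCutDist (Wseq n) W) atTop (𝓝 0)) :
    Tendsto (fun n => HypergraphLimit.cutDist (HypergraphLimit.codegreeSection (Wseq n))
        (HypergraphLimit.codegreeSection W)) atTop (𝓝 0) ∧
    HypergraphLimit.SpectraConverge
      (fun n => (HypergraphLimit.codegreeSection (Wseq n)).op)
      (HypergraphLimit.codegreeSection W).op 0 ∧
    ∀ ε : ℝ, 0 < ε →
      (∀ n, ∀ᵐ x : unitInterval, ε < (HypergraphLimit.codegreeSection (Wseq n)).degree x) →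
      ∃ (hn : ∀ n, HypergraphLimit.SquareIntegrable
            (HypergraphLimit.codegreeSection (Wseq n)).rwKernel)
        (h : HypergraphLimit.SquareIntegrable (HypergraphLimit.codegreeSection W).rwKernel),
        HypergraphLimit.SpectraConverge
          (fun n => (HypergraphLimit.codegreeSection (Wseq n)).laplacian (hn n))
          ((HypergraphLimit.codegreeSection W).laplacian h) 1 := by
  have hcut : Tendsto (fun n => HypergraphLimit.cutDist (HypergraphLimit.codegreeSection (Wseq n))
      (HypergraphLimit.codegreeSection W)) atTop (𝓝 0) :=
    squeeze_zero (fun _ => HypergraphLimit.cutDist_nonneg _ _)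
      (fun n => HypergraphLimit.cutDist_codegreeSection_le (Wseq n) W) hconv
  exact ⟨hcut, HypergraphLimit.spectraConverge_op hcut, fun ε hε hd =>
    HypergraphLimit.spectraConverge_laplacian hcut hε fun n => (hd n).mono fun _ h => h.le⟩
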